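/- **Setting.** Fix integers $m\ge 2$, $r\ge 2$ and constants $c_0,c_2,c_3>0$. For each $n$, a random hypergraph on $[n]$ is observed, whose hyperedges are nonempty subsets of $[n]$ with at most $m$ elements; put $\varphi(n,m)=\sum_{k=1}^m\binom nk$. Add a null vertex $n+1$. The adjacency tensor $\mathcal A=(a_{i_1\dots i_m})$, $i_1,\dots,i_m\in[n+1]$, has $a_{i_1\dots i_m}=1$ if the multiset $\{\{i_1,\dots,i_m\}\}$, with all copies of $n+1$ removed, is a hyperedge, and $0$ otherwise. Let $\mathcal D_n$ be the set of tuples $i_1\le\dots\le i_m$ in $[n+1]$ whose entries other than $n+1$ are distinct and at least one in number (so that $|\mathcal D_n|=\varphi(n,m)$). For a matrix $\alpha$ with $r$ columns let $\Theta(\alpha)$ be the tensor of order $m$ with entries $\theta_{i_1\dots i_m}(\alpha)=\sum_{j=1}^r\prod_{l=1}^m\alpha_{i_l j}$. Call $\alpha\in\mathbb R^{(n+1)\times r}$ admissible if its last row is $(1,\dots,1)$ and all other rows satisfy $\|\alpha_i\|_2\le c_0$. Let $s_n\in(0,1)$ be sparsity factors with $\sup_n s_n<1$ (possibly $s_n\to0$),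 let $\epsilon_n,\lambda_{0n},\lambda_{1n}>0$, let $K=K_n$ be the number of communities, let $\alpha^*=\alpha^*_n$ be admissible and let $\psi^*=\psi^*_n:[n]\to[K]$ be the true community assignment. The variables $a_{i_1\dots i_m}$, $(i_1,\dots,i_m)\in\mathcal D_n$, are independent Bernoulli variables with $P(a_{i_1\dots i_m}=1)=s_n\,(1+e^{-\theta_{i_1\dots i_m}(\alpha^*)})^{-1}$. For $\psi:[n]\to[K]$ let $Z_\psi\in\{0,1\}^{(n+1)\times(K+1)}$ be its membership matrix, with the null vertex alone in an extra class $K+1$. Put $J_0(\alpha)=\frac1n\|\alpha\|_F^2$ and $J_1(\alpha)=\min_{\psi,\,C\in\mathbb R^{(K+1)\times r}}\frac1n\|\alpha-Z_\psi C\|_F^2$. Let $\hat\alpha$ be a minimizer over admissible $\alpha$ of $$\frac1{\varphi(n,m)}\sum_{(i_1,\dots,i_m)\in\mathcal D_n}L(\theta_{i_1\dots i_m}(\alpha);a_{i_1\dots i_m})+\lambda_{0n}J_0(\alpha)+\lambda_{1n}J_1(\alpha),$$ where $L(\theta;a)=\log\big(1+\frac{s_n}{1-s_n+e^{-\theta}}\big)-a\log\frac{s_n}{1-s_n+e^{-\theta}}$.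 Let $\hat C\in\arg\min_C\min_\psi\|\hat\alpha-Z_\psi C\|_F$ and $\hat\psi_i\in\arg\min_{k\in[K]}\|\hat\alpha_i-\hat C_k\|_2$ for $i\in[n]$ (any choice of the minimizers). The error is $\mathrm{err}(\psi^*,\hat\psi)=\min_{\pi\in S_K}\frac1n\sum_{i=1}^n\mathbf 1\{\psi^*_i\ne\pi(\hat\psi_i)\}$. Let $n_k=|\{i\in[n]:\psi^*_i=k\}|$, let $C^*\in\mathbb R^{K\times r}$ have rows $C^*_k=\frac1{n_k}\sum_{i:\psi^*_i=k}\alpha^*_i$, let $Z^*=Z_{\psi^*}$, and let $\mathcal B^*=\Theta(C^*)$, with $\mathcal B^*_k$ its sub-tensor obtained by fixing the first index as $k$. **Theorem 2.** Assume: 1. $\lambda_{0n}J_0(\alpha^*)+\lambda_{1n}J_1(\alpha^*)<\frac12\epsilon_n$ for all large $n$, and $n\,\varphi(n,m)^{-1}\epsilon_n^{-1}\log\epsilon_n^{-1/2}\to0$. 2. The true communities are those encoded in $\alpha^*$: $\lambda_{1n}\frac1n\big\|\alpha^*-Z^*\binom{C^*}{\mathbf 1_r^{T}}\big\|_F^2=O(\epsilon_n)$.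 (Given 1, this holds in particular when $\psi^*$, with the centers $C^*$, attains the minimum in $J_1(\alpha^*)$.) 3. (A) $\min_{k\ne k'}K^{-(m-1)/2}\|\mathcal B^*_k-\mathcal B^*_{k'}\|_F\ge c_2$ for all large $n$. 4. (B) $\min_k n_k>0$ and $\max_k n_k/\min_k n_k\le c_3$ for all large $n$. 5. $\lim_{n\to\infty}\lambda_{1n}\epsilon_n s_n^{-2}(\log s_n^{-1})^{-1}$ exists in $(0,+\infty]$, and $K=o(\sqrt{s_n/\epsilon_n})$. Then $\mathrm{err}(\psi^*,\hat\psi)=O_p(K\epsilon_n/s_n)$. -/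

import Mathlib

open MeasureTheory ProbabilityTheory Filter Topology Asymptotics

noncomputable section

namespace HEM

/-- Euclidean (Frobenius) norm of a finite real array: a vector, or a tensor indexed by tuples. -/
def arrayNorm {ι : Type*} [Fintype ι] (v : ι → ℝ) : ℝ :=
  √(∑ i, v i ^ 2)

/-- Frobenius norm of a real matrix. -/
def frobNorm {ι κ : Type*} [Fintype ι] [Fintype κ] (M : Matrix ι κ ℝ) : ℝ :=
  √(∑ i, ∑ j, M i j ^ 2)

/-- An undirected hypergraph with vertex set `Fin n`, all of whose hyperedges are nonempty sets of
at most `m` vertices. -/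
structure BoundedHypergraph (n m : ℕ) where
  /-- the set of hyperedges -/
  edges : Finset (Finset (Fin n))
  nonempty_of_mem : ∀ e ∈ edges, e.Nonempty
  card_le_of_mem : ∀ e ∈ edges, e.card ≤ m

/-- The multiset `{{i₁, …, i_m}}` with all copies of the null vertex removed. The vertices are
`Fin (n + 1)`; the null vertex is the last one. -/
def nonNull {n m : ℕ} (i : Fin m → Fin (n + 1)) : Multiset (Fin (n + 1)) :=
  (Finset.univ.val.map i).filter (fun v => v ≠ Fin.last n)

open Classical in
/-- The index tuples for which the order-specified augmented Kronecker delta vanishes: `i` is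
nondecreasing, and after removal of the null vertex its entries form a nonempty set (a nonempty
multiset without repetition). They correspond to the potential hyperedges. -/
def ordIndex (n m : ℕ) : Finset (Fin m → Fin (n + 1)) :=
  Finset.univ.filter (fun i => ((nonNull i).Nodup ∧ nonNull i ≠ 0) ∧ Monotone i)

/-- The number of potential hyperedges. -/
def phi (n m : ℕ) : ℕ :=
  ∑ k ∈ Finset.Icc 1 m, n.choose k

open Classical in
/-- The adjacency tensor of the augmented hypergraph: the entry at `i` is `1` if
`{{i₁, …, i_m}}` without the null vertex is a hyperedge, and `0` otherwise. -/
def adjTensor {n m : ℕ} (H : BoundedHypergraph n m) (i : Fin m → Fin (n + 1)) : ℝ :=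
  if ∃ e ∈ H.edges, nonNull i = e.val.map Fin.castSucc then 1 else 0

/-- The tensor `𝓘 ×₁ α ×₂ ⋯ ×ₘ α`, with `𝓘` the identity tensor of order `m` and dimension `r`:
its entry at `(i₁, …, i_m)` is `∑ j, α i₁ j * ⋯ * α i_m j`. -/
def cpTensor (m : ℕ) {ι : Type*} {r : ℕ} (α : Matrix ι (Fin r) ℝ) (i : Fin m → ι) : ℝ :=
  ∑ j : Fin r, ∏ l : Fin m, α (i l) j

/-- The sub-tensor obtained by fixing the first index of `T` as `k`. -/
def firstSlice {m : ℕ} {ι : Type*} (T : (Fin m → ι) → ℝ) (k : ι) (j : Fin (m - 1) → ι) : ℝ :=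
  T (fun l => if h : (l : ℕ) = 0 then k else j ⟨(l : ℕ) - 1, by have := l.2; omega⟩)

/-- Admissible embedding matrices: the null vertex is embedded as the all-ones vector, every other
vertex in the ball of radius `c₀`. -/
def IsAdmissible {n r : ℕ} (c₀ : ℝ) (α : Matrix (Fin (n + 1)) (Fin r) ℝ) : Prop :=
  (∀ j, α (Fin.last n) j = 1) ∧ ∀ i : Fin n, arrayNorm (α i.castSucc) ≤ c₀

/-- A community assignment extended to the null vertex, which gets the extra label. -/
def extendAssign {n K : ℕ} (ψ : Fin n → Fin K) : Fin (n + 1) → Fin (K + 1) :=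
  Fin.snoc (α := fun _ => Fin (K + 1)) (fun i => (ψ i).castSucc) (Fin.last K)

/-- The community membership matrix of an assignment. -/
def membership {n K : ℕ} (ψ : Fin n → Fin K) : Matrix (Fin (n + 1)) (Fin (K + 1)) ℝ :=
  Matrix.of fun i k => if k = extendAssign ψ i then 1 else 0

/-- First penalty: `‖α‖_F² / n`. -/
def J0 {n r : ℕ} (α : Matrix (Fin (n + 1)) (Fin r) ℝ) : ℝ :=
  (1 / (n : ℝ)) * frobNorm α ^ 2

/-- Second penalty: the minimum over membership matrices `Z` and center matrices `C` of
`‖α - Z C‖_F² / n`. -/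
def J1 {n r : ℕ} (K : ℕ) (α : Matrix (Fin (n + 1)) (Fin r) ℝ) : ℝ :=
  ⨅ p : (Fin n → Fin K) × Matrix (Fin (K + 1)) (Fin r) ℝ,
    (1 / (n : ℝ)) * frobNorm (α - membership p.1 * p.2) ^ 2

/-- The total penalty. -/
def penalty {n r : ℕ} (K : ℕ) (lam0 lam1 : ℝ) (α : Matrix (Fin (n + 1)) (Fin r) ℝ) : ℝ :=
  lam0 * J0 α + lam1 * J1 K α

/-- The negative log-likelihood of one hyperedge indicator `a` at parameter `θ`, with sparsity
factor `s`. -/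
def loss (s θ a : ℝ) : ℝ :=
  Real.log (1 + s / (1 - s + Real.exp (-θ))) - a * Real.log (s / (1 - s + Real.exp (-θ)))

/-- The regularized negative log-likelihood. -/
def objective {n m r : ℕ} (K : ℕ) (s lam0 lam1 : ℝ) (H : BoundedHypergraph n m)
    (α : Matrix (Fin (n + 1)) (Fin r) ℝ) : ℝ :=
  (1 / (phi n m : ℝ)) * ∑ i ∈ ordIndex n m, loss s (cpTensor m α i) (adjTensor H i)
    + penalty K lam0 lam1 α

/-- `α` minimizes the regularized negative log-likelihood among the admissible embeddings. -/
def IsEstimator {n m r : ℕ} (c₀ : ℝ) (K : ℕ) (s lam0 lam1 : ℝ) (H : BoundedHypergraph n m)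
    (α : Matrix (Fin (n + 1)) (Fin r) ℝ) : Prop :=
  IsAdmissible c₀ α ∧
    ∀ β : Matrix (Fin (n + 1)) (Fin r) ℝ, IsAdmissible c₀ β → objective K s lam0 lam1 H α ≤ objective K s lam0 lam1 H β

/-- `C` minimizes `min_Z ‖α - Z C‖_F` over all center matrices. -/
def IsKMeansCenter {n r K : ℕ} (α : Matrix (Fin (n + 1)) (Fin r) ℝ)
    (C : Matrix (Fin (K + 1)) (Fin r) ℝ) : Prop :=
  ∀ C' : Matrix (Fin (K + 1)) (Fin r) ℝ,
    (⨅ ψ : Fin n → Fin K, frobNorm (α - membership ψ * C)) ≤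
      ⨅ ψ : Fin n → Fin K, frobNorm (α - membership ψ * C')

/-- `ψ` sends every vertex to a nearest one of the first `K` k-means centers of `α`. -/
def IsKMeansAssignment {n r K : ℕ} (α : Matrix (Fin (n + 1)) (Fin r) ℝ)
    (ψ : Fin n → Fin K) : Prop :=
  ∃ C : Matrix (Fin (K + 1)) (Fin r) ℝ, IsKMeansCenter α C ∧
    ∀ (i : Fin n) (k : Fin K),
      arrayNorm (α i.castSucc - C (ψ i).castSucc) ≤ arrayNorm (α i.castSucc - C k.castSucc)

/-- The size of community `k`. -/
def commSize {n K : ℕ} (ψ : Fin n → Fin K) (k : Fin K) : ℕ :=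
  (Finset.univ.filter (fun i => ψ i = k)).card

/-- The community embedding centers: row `k` is the mean of the embeddings of community `k`. -/
def centers {n r K : ℕ} (α : Matrix (Fin (n + 1)) (Fin r) ℝ) (ψ : Fin n → Fin K) :
    Matrix (Fin K) (Fin r) ℝ :=
  Matrix.of fun k j =>
    (1 / (commSize ψ k : ℝ)) * ∑ i ∈ Finset.univ.filter (fun i => ψ i = k), α i.castSucc j

/-- A center matrix, with the all-ones center of the null vertex appended as a last row. -/
def withNullCenter {r K : ℕ} (C : Matrix (Fin K) (Fin r) ℝ) : Matrix (Fin (K + 1)) (Fin r) ℝ :=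
  Matrix.of (Fin.snoc (α := fun _ => Fin r → ℝ) (fun k => C k) (fun _ => 1))

/-- Well separated communities, with separation constant `c₂`. -/
def WellSeparated {n r K : ℕ} (m : ℕ) (c₂ : ℝ) (α : Matrix (Fin (n + 1)) (Fin r) ℝ)
    (ψ : Fin n → Fin K) : Prop :=
  ∀ k k' : Fin K, k ≠ k' →
    c₂ ≤ (1 / (K : ℝ) ^ (((m : ℝ) - 1) / 2)) *
      arrayNorm (firstSlice (cpTensor m (centers α ψ)) k
        - firstSlice (cpTensor m (centers α ψ)) k')

/-- Balanced communities: all are nonempty and the ratio of any two sizes is at most `c₃`. -/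
def BalancedSizes {n K : ℕ} (c₃ : ℝ) (ψ : Fin n → Fin K) : Prop :=
  (∀ k, 0 < commSize ψ k) ∧ ∀ k k' : Fin K, (commSize ψ k : ℝ) / (commSize ψ k' : ℝ) ≤ c₃

/-- The minimum scaled Hamming distance between two assignments, up to relabelling. -/
def err {n K : ℕ} (ψ ψ' : Fin n → Fin K) : ℝ :=
  ⨅ π : Equiv.Perm (Fin K), (1 / (n : ℝ)) * ∑ i, if ψ i ≠ π (ψ' i) then (1 : ℝ) else 0

/-- The random hypergraph `H` follows the hypergraph embedding model with sparsity factor `s` and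
embedding `α`: the potential hyperedges appear independently of each other, the one indexed by `i`
with probability `s / (1 + exp (-θ_i))`. -/
structure IsModel {n m r : ℕ} {Ω : Type*} [MeasurableSpace Ω] (μ : Measure Ω)
    (s : ℝ) (α : Matrix (Fin (n + 1)) (Fin r) ℝ) (H : Ω → BoundedHypergraph n m) : Prop where
  measurable : ∀ i ∈ ordIndex n m, MeasurableSet {ω | adjTensor (H ω) i = 1}
  prob : ∀ i ∈ ordIndex n m,
    μ {ω | adjTensor (H ω) i = 1} = ENNReal.ofReal (s / (1 + Real.exp (-cpTensor m α i)))
  indep : iIndepSet (fun i : ordIndex n m => {ω | adjTensor (H ω) i = 1}) μ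

/-- `X n = O_p(b n)`: for every `δ > 0` there is `M` such that `|X n| ≤ M |b n|` outside an event of
probability at most `δ`, for all large `n`. -/
def IsBigOInProb {Ω : ℕ → Type*} [∀ n, MeasurableSpace (Ω n)] (μ : ∀ n, Measure (Ω n))
    (X : ∀ n, Ω n → ℝ) (b : ℕ → ℝ) : Prop :=
  ∀ δ : ℝ, 0 < δ → ∃ M : ℝ, 0 < M ∧
    ∀ᶠ n in atTop, μ n {ω | M * |b n| < |X n ω|} ≤ ENNReal.ofReal δ

end HEM

end

open HEM

/-!
The loss is the negative log-likelihood of independent Bernoulli variables with success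
probabilities `edgeProb s θ`. For a fixed embedding `β`, the square root of the likelihood ratio
against the true embedding has an expectation equal to a product of Hellinger affinities, which is
at most `exp (-(s κ / 2) * ∑ (θ(β) - θ(α*))²)`; the curvature `κ` depends only on a bound for the
parameters. A Chernoff bound (`measure_loss_sub_ge_le`) and a union bound over a grid of step
proportional to `ε` then control the likelihood ratio of all embeddings at once
(`exists_event_logRatio_le`): the loss is Lipschitz in the embedding, and the rate condition says
that the entropy of the grid, of order `n log (1 / ε)`, is negligible against `φ(n, m) ε`
(`grid_union_bound_le`).
Together with the minimality of the estimator this bounds its squared tensor distance to the truth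
by `O(φ(n, m) ε / s)` and its second penalty by `O(ε / λ₁) = O((ε / s)²)`
(`IsEstimator.penalty_and_sqDist_le`). No measurability of the estimator is involved.

The rest is deterministic. Separated centers are separated points in a bounded subset of a space of
fixed dimension, so the number of communities is bounded (`exists_card_communities_le`) and all
communities have size of order `n`. Call a vertex bad if it contributes a
constant fraction of the maximal order to the tensor distance, or is far from its center in one of
the two embeddings; at most `O(n ε / s)` vertices are bad. Two good vertices with the same
estimated label have almost the same estimated tensor slices; if their true labels differed, their
true slices would differ by about `c₂` on a whole block of tuples of distinct vertices, so one of
them would contribute too much to the tensor distance (`vertexDist_add_ge`). Hence on the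
good vertices the estimated labels determine the true ones, and since every community has a good
vertex, the correspondence is a permutation of the labels (`err_le_card_div`). The error is thus
`O(ε / s)`, which is at most `O(K ε / s)`.
-/

namespace HEM

/-! ### Lipschitz bounds for the low-rank tensor and the loss -/

lemma abs_prod_sub_prod_le {ι : Type*} (S : Finset ι) {R δ : ℝ} (hR : 1 ≤ R) (hδ : 0 ≤ δ)
    (a b : ι → ℝ) (ha : ∀ l, |a l| ≤ R) (hb : ∀ l, |b l| ≤ R) (hab : ∀ l, |a l - b l| ≤ δ) :
    |∏ l ∈ S, a l - ∏ l ∈ S, b l| ≤ S.card * R ^ S.card * δ := by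
  classical
  have hR0 : 0 ≤ R := by linarith
  induction S using Finset.induction_on with
  | empty => simp
  | insert x S hx ih =>
    rw [Finset.prod_insert hx, Finset.prod_insert hx, Finset.card_insert_of_notMem hx]
    have hpb : |∏ l ∈ S, b l| ≤ R ^ S.card := by
      rw [Finset.abs_prod]
      exact (Finset.prod_le_prod (fun l _ => abs_nonneg _) fun l _ => hb l).trans (by simp)
    have hRS : R ^ S.card ≤ R ^ (S.card + 1) := pow_le_pow_right₀ hR (Nat.le_succ _)
    calc |a x * ∏ l ∈ S, a l - b x * ∏ l ∈ S, b l|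
        = |a x * (∏ l ∈ S, a l - ∏ l ∈ S, b l) + (a x - b x) * ∏ l ∈ S, b l| := by ring_nf
      _ ≤ |a x| * |∏ l ∈ S, a l - ∏ l ∈ S, b l| + |a x - b x| * |∏ l ∈ S, b l| := by
          rw [← abs_mul, ← abs_mul]; exact abs_add_le _ _
      _ ≤ R * (S.card * R ^ S.card * δ) + δ * R ^ (S.card + 1) := by
          gcongr
          · exact ha x
          · exact hab x
          · exact hpb.trans hRS
      _ = (S.card + 1 : ℕ) * R ^ (S.card + 1) * δ := by push_cast; ring

/-- The low-rank tensor is Lipschitz in the factors, in the sup norm. -/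
lemma abs_cpTensor_sub_le {m r : ℕ} {ι κ : Type*} {R δ : ℝ} (hR : 1 ≤ R) (hδ : 0 ≤ δ)
    (α : Matrix ι (Fin r) ℝ) (β : Matrix κ (Fin r) ℝ) (f : Fin m → ι) (g : Fin m → κ)
    (hα : ∀ l j, |α (f l) j| ≤ R) (hβ : ∀ l j, |β (g l) j| ≤ R)
    (hαβ : ∀ l j, |α (f l) j - β (g l) j| ≤ δ) :
    |cpTensor m α f - cpTensor m β g| ≤ r * m * R ^ m * δ := by
  unfold cpTensor
  rw [← Finset.sum_sub_distrib]
  refine (Finset.abs_sum_le_sum_abs _ _).trans ?_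
  have key : ∀ j ∈ (Finset.univ : Finset (Fin r)),
      |∏ l, α (f l) j - ∏ l, β (g l) j| ≤ m * R ^ m * δ := fun j _ => by
    simpa using abs_prod_sub_prod_le Finset.univ hR hδ (fun l => α (f l) j) (fun l => β (g l) j)
      (fun l => hα l j) (fun l => hβ l j) (fun l => hαβ l j)
  refine (Finset.sum_le_sum key).trans ?_
  simp [mul_assoc]

lemma abs_cpTensor_le {m r : ℕ} {ι : Type*} {R : ℝ} (α : Matrix ι (Fin r) ℝ) (f : Fin m → ι)
    (hα : ∀ l j, |α (f l) j| ≤ R) : |cpTensor m α f| ≤ r * R ^ m := by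
  unfold cpTensor
  refine (Finset.abs_sum_le_sum_abs _ _).trans ?_
  have key : ∀ j ∈ (Finset.univ : Finset (Fin r)), |∏ l, α (f l) j| ≤ R ^ m := fun j _ => by
    rw [Finset.abs_prod]
    exact (Finset.prod_le_prod (fun l _ => abs_nonneg _) fun l _ => hα l j).trans (by simp)
  refine (Finset.sum_le_sum key).trans ?_
  simp

lemma abs_log_add_exp_neg_sub_le {c : ℝ} (hc : 0 ≤ c) (x y : ℝ) :
    |Real.log (c + Real.exp (-x)) - Real.log (c + Real.exp (-y))| ≤ |x - y| := by
  wlog h : x ≤ y generalizing x y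
  · rw [abs_sub_comm, abs_sub_comm x]; exact this y x (le_of_not_ge h)
  have hx := Real.exp_pos (-x)
  have hy := Real.exp_pos (-y)
  have h1 : Real.exp (-y) ≤ Real.exp (-x) := Real.exp_le_exp.2 (by linarith)
  have h2 : Real.log (c + Real.exp (-y)) ≤ Real.log (c + Real.exp (-x)) :=
    Real.log_le_log (by positivity) (by linarith)
  rw [abs_of_nonneg (by linarith), abs_sub_comm, abs_of_nonneg (by linarith)]
  have h3 : c + Real.exp (-x) ≤ Real.exp (y - x) * (c + Real.exp (-y)) := by
    have e1 : Real.exp (y - x) * Real.exp (-y) = Real.exp (-x) := by rw [← Real.exp_add]; ring_nf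
    have e2 : 1 ≤ Real.exp (y - x) := Real.one_le_exp (by linarith)
    nlinarith
  have h4 := Real.log_le_log (by positivity) h3
  rw [Real.log_mul (Real.exp_pos _).ne' (by positivity), Real.log_exp] at h4
  linarith

/-- The success probability `s / (1 + exp (-θ))` of a hyperedge indicator with parameter `θ`; the
loss is the corresponding negative log-likelihood. -/
noncomputable def edgeProb (s θ : ℝ) : ℝ := s / (1 + Real.exp (-θ))

lemma edgeProb_pos {s : ℝ} (hs : 0 < s) (θ : ℝ) : 0 < edgeProb s θ := by
  unfold edgeProb; positivity

lemma edgeProb_lt_one {s : ℝ} (hs1 : s < 1) (θ : ℝ) : edgeProb s θ < 1 := by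
  have := Real.exp_pos (-θ)
  unfold edgeProb
  rw [div_lt_one (by positivity)]
  linarith

lemma loss_zero {s : ℝ} (hs1 : s < 1) (θ : ℝ) :
    loss s θ 0 = Real.log (1 + Real.exp (-θ)) - Real.log ((1 - s) + Real.exp (-θ)) := by
  have h := Real.exp_pos (-θ)
  have h2 : 0 < 1 - s + Real.exp (-θ) := by linarith
  rw [loss, zero_mul, sub_zero, ← Real.log_div (by positivity) h2.ne']
  congr 1
  field_simp
  ring

lemma loss_one {s : ℝ} (hs : 0 < s) (hs1 : s < 1) (θ : ℝ) :
    loss s θ 1 = Real.log (1 + Real.exp (-θ)) - Real.log s := by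
  have h := Real.exp_pos (-θ)
  have h2 : 0 < 1 - s + Real.exp (-θ) := by linarith
  have h3 : loss s θ 1 = loss s θ 0 - Real.log (s / (1 - s + Real.exp (-θ))) := by
    simp [loss]
  rw [h3, loss_zero hs1, Real.log_div hs.ne' h2.ne']
  ring

lemma exp_neg_loss_zero {s : ℝ} (hs1 : s < 1) (θ : ℝ) :
    Real.exp (-loss s θ 0) = 1 - edgeProb s θ := by
  have h := Real.exp_pos (-θ)
  have h2 : 0 < 1 - s + Real.exp (-θ) := by linarith
  rw [loss_zero hs1, neg_sub, ← Real.log_div h2.ne' (by positivity), Real.exp_log (by positivity),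
    edgeProb]
  field_simp
  ring

lemma exp_neg_loss_one {s : ℝ} (hs : 0 < s) (hs1 : s < 1) (θ : ℝ) :
    Real.exp (-loss s θ 1) = edgeProb s θ := by
  have h := Real.exp_pos (-θ)
  rw [loss_one hs hs1, neg_sub, ← Real.log_div hs.ne' (by positivity),
    Real.exp_log (by positivity), edgeProb]

lemma abs_loss_sub_le {s a : ℝ} (hs : 0 < s) (hs1 : s < 1) (ha : a = 0 ∨ a = 1) (x y : ℝ) :
    |loss s x a - loss s y a| ≤ 2 * |x - y| := by
  have h1 := abs_log_add_exp_neg_sub_le (c := 1) zero_le_one x y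
  rcases ha with rfl | rfl
  · have h2 := abs_log_add_exp_neg_sub_le (c := 1 - s) (by linarith) x y
    rw [loss_zero hs1, loss_zero hs1]
    rw [abs_le] at h1 h2 ⊢
    constructor <;> linarith
  · rw [loss_one hs hs1, loss_one hs hs1]
    rw [abs_le] at h1 ⊢
    have := abs_nonneg (x - y)
    constructor <;> linarith

/-! ### The Hellinger affinity of two Bernoulli laws -/

/-- The Hellinger affinity of two Bernoulli laws is bounded through the squared distance of the
square roots of the success probabilities. -/
lemma affinity_le {p q : ℝ} (hp : 0 ≤ p) (hp1 : p ≤ 1) (hq : 0 ≤ q) (hq1 : q ≤ 1) :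
    √(p * q) + √((1 - p) * (1 - q)) ≤ Real.exp (-(1 / 2) * (√p - √q) ^ 2) := by
  have e := Real.add_one_le_exp (-(1 / 2) * (√p - √q) ^ 2)
  have h1 : √((1 - p) * (1 - q)) ≤ ((1 - p) + (1 - q)) / 2 := by
    rw [Real.sqrt_le_left (by linarith)]
    nlinarith [sq_nonneg (p - q)]
  rw [Real.sqrt_mul hp]
  nlinarith [Real.sq_sqrt hp, Real.sq_sqrt hq]

/-- The curvature constant of the logistic link on `[-B, B]`: a lower bound, up to the sparsity
factor, of the ratio of the squared Hellinger distance to the squared parameter distance. -/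
noncomputable def curvature (B : ℝ) : ℝ := (Real.exp (-B) / (1 + Real.exp B) ^ 2 / 2) ^ 2

lemma curvature_pos (B : ℝ) : 0 < curvature B := by
  unfold curvature; positivity

lemma curvature_mul_sq_le {s B x y : ℝ} (hs : 0 < s) (hx : |x| ≤ B) (hy : |y| ≤ B) :
    s * curvature B * (x - y) ^ 2 ≤ (√(edgeProb s x) - √(edgeProb s y)) ^ 2 := by
  wlog h : x ≤ y generalizing x y
  · have := this hy hx (le_of_not_ge h)
    nlinarith
  rw [abs_le] at hx hy
  have ex := Real.exp_pos (-x)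
  have ey := Real.exp_pos (-y)
  have eB := Real.exp_pos B
  have hxB : Real.exp (-x) ≤ Real.exp B := Real.exp_le_exp.2 (by linarith)
  have hyB : Real.exp (-y) ≤ Real.exp B := Real.exp_le_exp.2 (by linarith)
  -- with `u, v` the square roots of the logistic probabilities, `v - u ≥ (v² - u²) / 2`
  set u := √(1 / (1 + Real.exp (-x))) with hu
  set v := √(1 / (1 + Real.exp (-y))) with hv
  have hpx : √(edgeProb s x) = √s * u := by
    rw [hu, ← Real.sqrt_mul hs.le]; congr 1; unfold edgeProb; ring
  have hpy : √(edgeProb s y) = √s * v := by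
    rw [hv, ← Real.sqrt_mul hs.le]; congr 1; unfold edgeProb; ring
  have hu2 : u ^ 2 = 1 / (1 + Real.exp (-x)) := Real.sq_sqrt (by positivity)
  have hv2 : v ^ 2 = 1 / (1 + Real.exp (-y)) := Real.sq_sqrt (by positivity)
  have hu0 : 0 ≤ u := Real.sqrt_nonneg _
  have hv0 : 0 ≤ v := Real.sqrt_nonneg _
  have hu1 : u ≤ 1 := by
    refine Real.sqrt_le_one.2 ?_
    rw [div_le_one (by positivity)]; linarith
  have hv1 : v ≤ 1 := by
    refine Real.sqrt_le_one.2 ?_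
    rw [div_le_one (by positivity)]; linarith
  have hdiff : Real.exp (-B) / (1 + Real.exp B) ^ 2 * (y - x) ≤ v ^ 2 - u ^ 2 := by
    have h1 : Real.exp (-B) * (y - x) ≤ Real.exp (-x) - Real.exp (-y) := by
      have e1 : Real.exp (-x) = Real.exp (-y) * Real.exp (y - x) := by
        rw [← Real.exp_add]; ring_nf
      have e2 := Real.add_one_le_exp (y - x)
      have e3 : Real.exp (-B) ≤ Real.exp (-y) := Real.exp_le_exp.2 (by linarith)
      nlinarith
    have h2 : v ^ 2 - u ^ 2 = (Real.exp (-x) - Real.exp (-y)) /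
        ((1 + Real.exp (-x)) * (1 + Real.exp (-y))) := by
      rw [hu2, hv2]; field_simp; ring
    rw [h2, div_mul_eq_mul_div]
    have h3 : 0 ≤ Real.exp (-x) - Real.exp (-y) :=
      le_trans (mul_nonneg (Real.exp_pos _).le (by linarith)) h1
    refine div_le_div₀ h3 h1 (by positivity) ?_
    rw [sq]; gcongr
  have hvu : Real.exp (-B) / (1 + Real.exp B) ^ 2 / 2 * (y - x) ≤ v - u := by
    have h4 : 0 ≤ v - u := by
      have h5 : 0 ≤ Real.exp (-B) / (1 + Real.exp B) ^ 2 * (y - x) :=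
        mul_nonneg (by positivity) (by linarith)
      by_contra h6
      nlinarith
    nlinarith
  rw [hpx, hpy]
  have h7 : (√s * u - √s * v) ^ 2 = s * (v - u) ^ 2 := by
    rw [← mul_sub, mul_pow, Real.sq_sqrt hs.le]; ring
  rw [h7, mul_assoc]
  refine mul_le_mul_of_nonneg_left ?_ hs.le
  have h8 := pow_le_pow_left₀ (mul_nonneg (by positivity) (by linarith)) hvu 2
  calc curvature B * (x - y) ^ 2
      = (Real.exp (-B) / (1 + Real.exp B) ^ 2 / 2 * (y - x)) ^ 2 := by unfold curvature; ring
    _ ≤ _ := h8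

/-! ### Tail bound for one likelihood ratio -/

section Tail

variable {Ω ι : Type*} [MeasurableSpace Ω] [Fintype ι] {μ : Measure Ω}

/-- The expected square root of the likelihood ratio of one Bernoulli variable is the Hellinger
affinity. -/
lemma integral_exp_half_loss_sub_le [IsProbabilityMeasure μ] {s B x y : ℝ} (hs : 0 < s)
    (hs1 : s < 1) (hx : |x| ≤ B) (hy : |y| ≤ B) {A : Set Ω} (hA : MeasurableSet A)
    (hP : μ A = ENNReal.ofReal (edgeProb s x)) :
    ∫ ω, Real.exp ((1 / 2) * (loss s x (A.indicator (fun _ => 1) ω) -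
      loss s y (A.indicator (fun _ => 1) ω))) ∂μ ≤
      Real.exp (-(1 / 2) * (s * curvature B * (x - y) ^ 2)) := by
  have hpx := edgeProb_pos hs x
  have hpy := edgeProb_pos hs y
  have hpx1 := edgeProb_lt_one hs1 x
  have hpy1 := edgeProb_lt_one hs1 y
  have hsqrt : ∀ {u v a b : ℝ}, 0 < a → Real.exp (-u) = a → Real.exp (-v) = b →
      a * Real.exp ((1 / 2) * (u - v)) = √(a * b) := by
    intro u v a b ha hu hv
    subst hu hv
    rw [← Real.exp_add, ← Real.exp_add, ← Real.exp_half]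
    ring_nf
  set c1 := Real.exp ((1 / 2) * (loss s x 1 - loss s y 1)) with hc1
  set c0 := Real.exp ((1 / 2) * (loss s x 0 - loss s y 0)) with hc0
  have hfun : (fun ω => Real.exp ((1 / 2) * (loss s x (A.indicator (fun _ => 1) ω) -
      loss s y (A.indicator (fun _ => 1) ω)))) =
      fun ω => c0 + (c1 - c0) * A.indicator (fun _ => (1 : ℝ)) ω := by
    funext ω
    by_cases h : ω ∈ A <;> simp [h, hc0, hc1]
  have hreal : μ.real A = edgeProb s x := by
    rw [measureReal_def, hP, ENNReal.toReal_ofReal hpx.le]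
  have hint : ∫ ω, A.indicator (fun _ => (1 : ℝ)) ω ∂μ = edgeProb s x := by
    rw [integral_indicator hA]; simp [hreal]
  rw [hfun, integral_add (integrable_const _)
    (((integrable_const _).indicator hA).const_mul _), integral_const_mul, hint]
  have e1 := hsqrt hpx (exp_neg_loss_one hs hs1 x) (exp_neg_loss_one hs hs1 y)
  have e0 := hsqrt (sub_pos.2 hpx1) (exp_neg_loss_zero hs1 x) (exp_neg_loss_zero hs1 y)
  have hsum : ∫ _ : Ω, c0 ∂μ + (c1 - c0) * edgeProb s x =
      √(edgeProb s x * edgeProb s y) + √((1 - edgeProb s x) * (1 - edgeProb s y)) := by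
    rw [← e1, ← e0, ← hc1, ← hc0]; simp; ring
  rw [hsum]
  refine (affinity_le hpx.le hpx1.le hpy.le hpy1.le).trans (Real.exp_le_exp.2 ?_)
  have := curvature_mul_sq_le hs hx hy
  linarith

/-- Chernoff bound at exponent `1 / 2` for the log-likelihood ratio of independent Bernoulli
variables against a fixed alternative. -/
lemma measure_loss_sub_ge_le [IsProbabilityMeasure μ] {s B : ℝ} (hs : 0 < s) (hs1 : s < 1)
    {x y : ι → ℝ} (hx : ∀ i, |x i| ≤ B) (hy : ∀ i, |y i| ≤ B) {A : ι → Set Ω}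
    (hA : ∀ i, MeasurableSet (A i)) (hP : ∀ i, μ (A i) = ENNReal.ofReal (edgeProb s (x i)))
    (hind : iIndepSet A μ) (u : ℝ) :
    μ {ω | 2 * u ≤ ∑ i, (loss s (x i) ((A i).indicator (fun _ => 1) ω) -
        loss s (y i) ((A i).indicator (fun _ => 1) ω)) +
        s * curvature B * ∑ i, (x i - y i) ^ 2} ≤ ENNReal.ofReal (Real.exp (-u)) := by
  set f : ι → ℝ → ℝ := fun i a => Real.exp ((1 / 2) * (loss s (x i) a - loss s (y i) a)) with hf
  set X : ι → Ω → ℝ := fun i => (A i).indicator (fun _ => 1) with hX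
  have hXm : ∀ i, Measurable (X i) := fun i => measurable_const.indicator (hA i)
  have hfm : ∀ i, Measurable (f i) := fun i => by
    simp only [hf, loss]; fun_prop
  have hXind : iIndepFun X μ := hind.iIndepFun_indicator
  have hbd : ∀ i, ∃ C, ∀ ω, ‖f i (X i ω)‖ ≤ C := fun i =>
    ⟨max (f i 1) (f i 0), fun ω => by
      rw [Real.norm_of_nonneg (Real.exp_pos _).le]
      by_cases h : ω ∈ A i
      · rw [show X i ω = 1 from Set.indicator_of_mem h _]; exact le_max_left _ _
      · rw [show X i ω = 0 from Set.indicator_of_notMem h _]; exact le_max_right _ _⟩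
  choose C hC using hbd
  have hmeas : Measurable fun ω => ∏ i, f i (X i ω) :=
    Finset.measurable_fun_prod _ fun i _ => (hfm i).comp (hXm i)
  have hint : Integrable (fun ω => ∏ i, f i (X i ω)) μ := by
    refine Integrable.of_bound hmeas.aestronglyMeasurable (∏ i, C i) (ae_of_all _ fun ω => ?_)
    rw [norm_prod]
    exact Finset.prod_le_prod (fun i _ => norm_nonneg _) fun i _ => hC i ω
  set T := s * curvature B * ∑ i, (x i - y i) ^ 2 with hT
  have hE : ∫ ω, ∏ i, f i (X i ω) ∂μ ≤ Real.exp (-(1 / 2) * T) := by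
    have h1 := hXind.integral_fun_prod_comp (fun i => (hXm i).aemeasurable)
      (fun i => (hfm i).aestronglyMeasurable (μ := μ.map (X i)))
    rw [h1, hT, Finset.mul_sum, Finset.mul_sum, Real.exp_sum]
    refine Finset.prod_le_prod (fun i _ => integral_nonneg fun ω => (Real.exp_pos _).le) ?_
    intro i _
    exact integral_exp_half_loss_sub_le hs hs1 (hx i) (hy i) (hA i) (hP i)
  have hM := mul_meas_ge_le_integral_of_nonneg (μ := μ)
    (ae_of_all _ fun ω => Finset.prod_nonneg fun i _ => (Real.exp_pos _).le) hint
    (Real.exp (u - (1 / 2) * T))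
  have hset : {ω | 2 * u ≤ ∑ i, (loss s (x i) (X i ω) - loss s (y i) (X i ω)) + T} ⊆
      {ω | Real.exp (u - (1 / 2) * T) ≤ ∏ i, f i (X i ω)} := by
    intro ω hω
    simp only [Set.mem_ofPred_eq, hf] at hω ⊢
    rw [← Real.exp_sum, ← Finset.mul_sum, Real.exp_le_exp]
    linarith
  refine (measure_mono hset).trans ?_
  rw [← ENNReal.ofReal_toReal (measure_ne_top μ _)]
  refine ENNReal.ofReal_le_ofReal ?_
  have h2 := hM.trans hE
  have h3 : Real.exp (-(1 / 2) * T) = Real.exp (u - (1 / 2) * T) * Real.exp (-u) := by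
    rw [← Real.exp_add]; ring_nf
  rw [h3] at h2
  exact le_of_mul_le_mul_left h2 (Real.exp_pos _)

end Tail

/-! ### A finite grid of embedding matrices -/

/-- The point of the grid of step `δ` on `[-R, R]` with index `k`. Points beyond `R` are clamped to
`R`, so that all `N + 1` indices give points of the interval. -/
noncomputable def gridPoint (R δ : ℝ) (N : ℕ) (k : Fin (N + 1)) : ℝ := min (-R + δ * k) R

lemma abs_gridPoint_le {R δ : ℝ} (hR : 0 ≤ R) (hδ : 0 ≤ δ) {N : ℕ} (k : Fin (N + 1)) :
    |gridPoint R δ N k| ≤ R := by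
  have : 0 ≤ δ * (k : ℕ) := by positivity
  exact abs_le.2 ⟨le_min (by linarith) (by linarith), min_le_right _ _⟩

/-- The index of the grid cell that contains `x`. The reduction modulo `N + 1` is only there to land
in `Fin (N + 1)`: it has no effect if `|x| ≤ R` and `2 * R / δ ≤ N`. -/
noncomputable def gridIndex (R δ : ℝ) (N : ℕ) (x : ℝ) : Fin (N + 1) :=
  Fin.ofNat (N + 1) ⌊(x + R) / δ⌋₊

lemma gridIndex_spec {R δ x : ℝ} {N : ℕ} (hδ : 0 < δ) (hN : 2 * R / δ ≤ N) (hx : |x| ≤ R) :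
    δ * (gridIndex R δ N x : ℕ) ≤ x + R ∧ x + R < δ * (gridIndex R δ N x : ℕ) + δ := by
  rw [abs_le] at hx
  have h0 : 0 ≤ (x + R) / δ := div_nonneg (by linarith) hδ.le
  have hle : ⌊(x + R) / δ⌋₊ ≤ N := by
    refine Nat.floor_le_of_le (le_trans ?_ hN)
    gcongr
    linarith
  have hval : ((gridIndex R δ N x : Fin (N + 1)) : ℕ) = ⌊(x + R) / δ⌋₊ := by
    simp only [gridIndex, Fin.ofNat]
    exact Nat.mod_eq_of_lt (Nat.lt_succ_of_le hle)
  rw [hval]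
  have h1 := Nat.floor_le h0
  have h2 := Nat.lt_floor_add_one ((x + R) / δ)
  rw [le_div_iff₀ hδ] at h1
  rw [div_lt_iff₀ hδ] at h2
  constructor <;> nlinarith

lemma abs_sub_gridPoint_le {R δ x : ℝ} {N : ℕ} (hδ : 0 < δ) (hN : 2 * R / δ ≤ N) (hx : |x| ≤ R) :
    |x - gridPoint R δ N (gridIndex R δ N x)| ≤ δ := by
  obtain ⟨h1, h2⟩ := gridIndex_spec hδ hN hx
  rw [abs_le] at hx
  have h3 : gridPoint R δ N (gridIndex R δ N x) = -R + δ * (gridIndex R δ N x : ℕ) :=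
    min_eq_left (by linarith)
  rw [h3, abs_le]
  constructor <;> linarith

lemma abs_sub_lt_of_gridIndex_eq {R δ x y : ℝ} {N : ℕ} (hδ : 0 < δ) (hN : 2 * R / δ ≤ N)
    (hx : |x| ≤ R) (hy : |y| ≤ R) (h : gridIndex R δ N x = gridIndex R δ N y) : |x - y| < δ := by
  obtain ⟨h1, h2⟩ := gridIndex_spec hδ hN hx
  obtain ⟨h3, h4⟩ := gridIndex_spec hδ hN hy
  rw [h] at h1 h2
  rw [abs_lt]
  constructor <;> linarith

/-- The matrix whose entries are the grid points with the given indices. -/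
noncomputable def gridMatrix {ι κ : Type*} (R δ : ℝ) (N : ℕ) (g : ι → κ → Fin (N + 1)) :
    Matrix ι κ ℝ :=
  Matrix.of fun i j => gridPoint R δ N (g i j)

/-! ### Counting potential hyperedges -/

/-- A monotone tuple is determined by its non-null entries, because the multiplicity of the null
vertex is then fixed by the length. -/
lemma eq_of_nonNull_eq {n m : ℕ} {f g : Fin m → Fin (n + 1)} (hf : Monotone f) (hg : Monotone g)
    (h : nonNull f = nonNull g) : f = g := by
  have key : ∀ u : Fin m → Fin (n + 1), Finset.univ.val.map u =
      nonNull u + Multiset.replicate (m - (nonNull u).card) (Fin.last n) := by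
    intro u
    have h1 := Multiset.filter_add_not (fun v => v ≠ Fin.last n) (Finset.univ.val.map u)
    simp only [not_not, Multiset.filter_eq'] at h1
    have h2 : ((Finset.univ.val.map u).filter fun v => v ≠ Fin.last n) = nonNull u := rfl
    rw [h2] at h1
    have h3 := congrArg Multiset.card h1
    simp only [Multiset.card_add, Multiset.card_replicate, Multiset.card_map,
      Finset.card_val, Finset.card_univ, Fintype.card_fin] at h3
    rw [show m - (nonNull u).card = (Finset.univ.val.map u).count (Fin.last n) by omega, h1]
  have hfg : Finset.univ.val.map f = Finset.univ.val.map g := by rw [key f, key g, h]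
  have hperm : (List.ofFn f).Perm (List.ofFn g) := by
    rw [← Multiset.coe_eq_coe, ← Fin.univ_val_map, ← Fin.univ_val_map, hfg]
  exact List.ofFn_injective
    (hperm.eq_of_pairwise' hf.sortedLE_ofFn.pairwise hg.sortedLE_ofFn.pairwise)

lemma card_ordIndex_le (n m : ℕ) : (ordIndex n m).card ≤ phi n m := by
  classical
  set T : Finset (Finset (Fin (n + 1))) := (Finset.Icc 1 m).biUnion fun k =>
    Finset.powersetCard k (Finset.univ.erase (Fin.last n)) with hT
  have hTcard : T.card ≤ phi n m := by
    refine Finset.card_biUnion_le.trans (Finset.sum_le_sum fun k _ => ?_)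
    rw [Finset.card_powersetCard, Finset.card_erase_of_mem (Finset.mem_univ _)]
    simp
  refine le_trans (Finset.card_le_card_of_injOn (fun i => (nonNull i).toFinset) ?_ ?_) hTcard
  · intro i hi
    simp only [ordIndex, Finset.coe_filter, Finset.mem_univ, true_and] at hi
    obtain ⟨⟨hnd, hne⟩, -⟩ := hi
    have hcard : (nonNull i).toFinset.card = (nonNull i).card :=
      Multiset.toFinset_card_of_nodup hnd
    have hle : (nonNull i).card ≤ m := by
      refine (Multiset.card_le_card (Multiset.filter_le _ _)).trans ?_
      simp
    have hpos : 0 < (nonNull i).card := Multiset.card_pos.2 hne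
    simp only [hT, Finset.coe_biUnion, Set.mem_iUnion, Finset.mem_coe, Finset.mem_Icc,
      Finset.mem_powersetCard, exists_prop]
    refine ⟨(nonNull i).card, ⟨hpos, hle⟩, fun v hv => ?_, hcard⟩
    rw [Multiset.mem_toFinset, nonNull, Multiset.mem_filter] at hv
    exact Finset.mem_erase.2 ⟨hv.2, Finset.mem_univ _⟩
  · intro i hi j hj hij
    simp only [ordIndex, Finset.coe_filter, Finset.mem_univ, true_and] at hi hj
    refine eq_of_nonNull_eq hi.2 hj.2 ?_
    have h1 : (nonNull i).dedup = (nonNull j).dedup := congrArg Finset.val hij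
    rwa [hi.1.1.dedup, hj.1.1.dedup] at h1

lemma phi_le {n : ℕ} (hn : 1 ≤ n) (m : ℕ) : phi n m ≤ m * n ^ m := by
  unfold phi
  calc ∑ k ∈ Finset.Icc 1 m, n.choose k ≤ ∑ _k ∈ Finset.Icc 1 m, n ^ m := by
        refine Finset.sum_le_sum fun k hk => (Nat.choose_le_pow n k).trans ?_
        exact Nat.pow_le_pow_right hn (Finset.mem_Icc.1 hk).2
    _ = m * n ^ m := by simp

lemma le_phi (n : ℕ) {m : ℕ} (hm : 1 ≤ m) : n ≤ phi n m := by
  unfold phi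
  have := Finset.single_le_sum (f := fun k => n.choose k) (fun _ _ => Nat.zero_le _)
    (Finset.mem_Icc.2 ⟨le_rfl, hm⟩)
  simpa using this

lemma castSucc_comp_mem_ordIndex {n m : ℕ} (hm : 1 ≤ m) {f : Fin m → Fin n} (hf : Monotone f)
    (hinj : Function.Injective f) : (fun l => (f l).castSucc) ∈ ordIndex n m := by
  classical
  have h1 : nonNull (fun l => (f l).castSucc) = Finset.univ.val.map fun l => (f l).castSucc := by
    rw [nonNull, Multiset.filter_eq_self]
    intro v hv
    obtain ⟨l, -, rfl⟩ := Multiset.mem_map.1 hv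
    exact (Fin.castSucc_lt_last _).ne
  simp only [ordIndex, Finset.mem_filter, Finset.mem_univ, true_and, h1]
  refine ⟨⟨?_, ?_⟩, fun a b hab => hf hab⟩
  · exact Multiset.Nodup.map ((Fin.castSucc_injective n).comp hinj) Finset.univ.nodup
  · rw [← Multiset.card_pos]
    simpa using Nat.pos_of_ne_zero (Nat.one_le_iff_ne_zero.1 hm)

open Classical in
/-- A nonnegative symmetric function summed over all tuples of distinct vertices is at most `m!`
times its sum over the potential hyperedges: sorting maps at most `m!` tuples to each of them. -/
lemma sum_injective_le_factorial_mul {n m : ℕ} (hm : 1 ≤ m) (D : (Fin m → Fin (n + 1)) → ℝ)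
    (hD : ∀ f, 0 ≤ D f) (hsymm : ∀ f (σ : Equiv.Perm (Fin m)), D (f ∘ σ) = D f) :
    ∑ f : Fin m → Fin n with Function.Injective f, D (fun l => (f l).castSucc) ≤
      (m.factorial : ℝ) * ∑ i ∈ ordIndex n m, D i := by
  set S : Finset (Fin m → Fin n) := Finset.univ.filter Function.Injective
  set e : (Fin m → Fin n) → (Fin m → Fin (n + 1)) × Equiv.Perm (Fin m) := fun f =>
    (fun l => ((f ∘ Tuple.sort f) l).castSucc, Tuple.sort f) with he
  have hinj : Set.InjOn e S := by
    intro f _ g _ hfg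
    have h1 : Tuple.sort f = Tuple.sort g := congrArg Prod.snd hfg
    have h2 := congrArg Prod.fst hfg
    funext l
    have h3 := congrFun h2 ((Tuple.sort f).symm l)
    simp only [he, Function.comp_apply] at h3
    rw [← h1] at h3
    simpa using h3
  have hval : ∀ f ∈ S, D (fun l => (f l).castSucc) = D (e f).1 := fun f _ =>
    (hsymm (fun l => (f l).castSucc) (Tuple.sort f)).symm
  rw [Finset.sum_congr rfl hval, ← Finset.sum_image (f := fun p => D p.1) hinj]
  calc ∑ p ∈ S.image e, D p.1 ≤ ∑ p ∈ ordIndex n m ×ˢ (Finset.univ : Finset (Equiv.Perm (Fin m))),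
        D p.1 := by
        refine Finset.sum_le_sum_of_subset_of_nonneg ?_ fun p _ _ => hD _
        intro p hp
        obtain ⟨f, hf, rfl⟩ := Finset.mem_image.1 hp
        refine Finset.mem_product.2 ⟨?_, Finset.mem_univ _⟩
        exact castSucc_comp_mem_ordIndex hm (Tuple.monotone_sort f)
          ((Finset.mem_filter.1 hf).2.comp (Tuple.sort f).injective)
    _ = (m.factorial : ℝ) * ∑ i ∈ ordIndex n m, D i := by
        rw [Finset.sum_product, Finset.mul_sum]
        simp [Fintype.card_perm]

lemma cpTensor_comp_perm {m r : ℕ} {ι : Type*} (α : Matrix ι (Fin r) ℝ) (f : Fin m → ι)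
    (σ : Equiv.Perm (Fin m)) : cpTensor m α (f ∘ σ) = cpTensor m α f := by
  unfold cpTensor
  exact Finset.sum_congr rfl fun j _ => Equiv.prod_comp σ fun l => α (f l) j

/-! ### The likelihood ratio uniformly over the embeddings -/

lemma IsAdmissible.abs_le {n r : ℕ} {c₀ : ℝ} {α : Matrix (Fin (n + 1)) (Fin r) ℝ}
    (h : IsAdmissible c₀ α) (i : Fin (n + 1)) (j : Fin r) : |α i j| ≤ max c₀ 1 := by
  refine Fin.lastCases ?_ (fun i => ?_) i
  · rw [h.1 j]; simp
  · refine le_trans ?_ ((h.2 i).trans (le_max_left _ _))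
    refine Real.abs_le_sqrt ?_
    exact Finset.single_le_sum (f := fun j => α i.castSucc j ^ 2) (fun _ _ => sq_nonneg _)
      (Finset.mem_univ j)

lemma curvature_le_one {B : ℝ} (hB : 0 ≤ B) : curvature B ≤ 1 := by
  unfold curvature
  have h1 : Real.exp (-B) ≤ 1 := Real.exp_le_one_iff.2 (by linarith)
  have h2 : 1 ≤ (1 + Real.exp B) ^ 2 := one_le_pow₀ (by linarith [Real.exp_pos B])
  have h3 : Real.exp (-B) / (1 + Real.exp B) ^ 2 ≤ 1 := (div_le_one (by positivity)).2 (by linarith)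
  refine pow_le_one₀ (by positivity) (by linarith)

lemma adjTensor_eq_zero_or_one {n m : ℕ} (H : BoundedHypergraph n m) (i : Fin m → Fin (n + 1)) :
    adjTensor H i = 0 ∨ adjTensor H i = 1 := by
  unfold adjTensor
  split_ifs <;> simp

/-- The log-likelihood ratio of `α` against `αs`; it is positive where `α` fits better. -/
noncomputable def logRatio {n m r : ℕ} (s : ℝ) (H : BoundedHypergraph n m)
    (αs α : Matrix (Fin (n + 1)) (Fin r) ℝ) : ℝ :=
  ∑ i ∈ ordIndex n m,
    (loss s (cpTensor m αs i) (adjTensor H i) - loss s (cpTensor m α i) (adjTensor H i))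

/-- The squared distance of the two tensors over the potential hyperedges. -/
noncomputable def sqDist {n r : ℕ} (m : ℕ) (αs α : Matrix (Fin (n + 1)) (Fin r) ℝ) : ℝ :=
  ∑ i ∈ ordIndex n m, (cpTensor m αs i - cpTensor m α i) ^ 2

lemma measure_logRatio_ge_le {n m r : ℕ} {Ω : Type*} [MeasurableSpace Ω] {μ : Measure Ω}
    [IsProbabilityMeasure μ] {s R : ℝ} (hs : 0 < s) (hs1 : s < 1)
    {αs β : Matrix (Fin (n + 1)) (Fin r) ℝ} (hαs : ∀ i j, |αs i j| ≤ R) (hβ : ∀ i j, |β i j| ≤ R)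
    {H : Ω → BoundedHypergraph n m} (hH : IsModel μ s αs H) (u : ℝ) :
    μ {ω | 2 * u ≤ logRatio s (H ω) αs β + s * curvature (r * R ^ m) * sqDist m αs β} ≤
      ENNReal.ofReal (Real.exp (-u)) := by
  have h := measure_loss_sub_ge_le (ι := ordIndex n m) (μ := μ) (B := r * R ^ m) hs hs1
    (x := fun i => cpTensor m αs i) (y := fun i => cpTensor m β i)
    (fun i => abs_cpTensor_le _ _ fun _ _ => hαs _ _)
    (fun i => abs_cpTensor_le _ _ fun _ _ => hβ _ _)
    (A := fun i => {ω | adjTensor (H ω) i = 1}) (fun i => hH.measurable i i.2)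
    (fun i => hH.prob i i.2) hH.indep u
  refine le_trans (le_of_eq ?_) h
  congr 1
  ext ω
  have hind : ∀ i : ordIndex n m,
      ({ω | adjTensor (H ω) i = 1} : Set Ω).indicator (fun _ => (1 : ℝ)) ω =
        adjTensor (H ω) i := by
    intro i
    rcases adjTensor_eq_zero_or_one (H ω) i with h0 | h1
    · simp [h0]
    · simp [h1]
  simp only [Set.mem_ofPred_eq, logRatio, sqDist, hind]
  rw [← Finset.sum_coe_sort (ordIndex n m), ← Finset.sum_coe_sort (ordIndex n m)]

/-- Both the log-likelihood ratio and the squared distance are stable under a small perturbation of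
the embedding. -/
lemma logRatio_add_sqDist_le_of_close {n m r : ℕ} {s R ε κ : ℝ} (hs : 0 < s) (hs1 : s < 1)
    (hR : 1 ≤ R) (hr : 1 ≤ r) (hm : 1 ≤ m) (hε : 0 < ε) (hε1 : ε ≤ 1) (hκ : 0 ≤ κ) (hκ1 : κ ≤ 1)
    {αs α β : Matrix (Fin (n + 1)) (Fin r) ℝ} (hα : ∀ i j, |α i j| ≤ R) (hβ : ∀ i j, |β i j| ≤ R)
    (hαβ : ∀ i j, |α i j - β i j| ≤ ε / (2 * (r * m * R ^ m))) (H : BoundedHypergraph n m)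
    (h : logRatio s H αs β + s * κ * sqDist m αs β ≤ 2 * (phi n m * ε)) :
    logRatio s H αs α + s * κ / 2 * sqDist m αs α ≤ 4 * (phi n m * ε) := by
  have hr' : (1 : ℝ) ≤ r := by exact_mod_cast hr
  have hm' : (1 : ℝ) ≤ m := by exact_mod_cast hm
  have hL : 0 < (r * m * R ^ m : ℝ) := by positivity
  have hθ : ∀ i, |cpTensor m α i - cpTensor m β i| ≤ ε / 2 := fun i => by
    refine (abs_cpTensor_sub_le hR (by positivity) α β i i (fun _ _ => hα _ _) (fun _ _ => hβ _ _)
      fun _ _ => hαβ _ _).trans (le_of_eq ?_)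
    field_simp
  have hcard : ((ordIndex n m).card : ℝ) ≤ phi n m := by exact_mod_cast card_ordIndex_le n m
  have h1 : logRatio s H αs α ≤ logRatio s H αs β + phi n m * ε := by
    have h2 : logRatio s H αs α - logRatio s H αs β ≤ ∑ _i ∈ ordIndex n m, ε := by
      rw [logRatio, logRatio, ← Finset.sum_sub_distrib]
      refine Finset.sum_le_sum fun i _ => ?_
      have h3 := abs_loss_sub_le hs hs1 (adjTensor_eq_zero_or_one H i) (cpTensor m α i)
        (cpTensor m β i)
      have h4 := hθ i
      rw [abs_le] at h3
      linarith [h3.1]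
    rw [Finset.sum_const, nsmul_eq_mul] at h2
    nlinarith
  have h5 : sqDist m αs α ≤ 2 * sqDist m αs β + phi n m * ε := by
    have h6 : sqDist m αs α ≤ 2 * sqDist m αs β + ∑ _i ∈ ordIndex n m, ε := by
      rw [sqDist, sqDist, Finset.mul_sum, ← Finset.sum_add_distrib]
      refine Finset.sum_le_sum fun i _ => ?_
      have h4 := abs_le.1 (hθ i)
      nlinarith [sq_nonneg ((cpTensor m αs i - cpTensor m β i) +
        (cpTensor m α i - cpTensor m β i))]
    rw [Finset.sum_const, nsmul_eq_mul] at h6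
    nlinarith
  have h7 : s * κ ≤ 1 := by nlinarith
  have h8 : 0 ≤ s * κ := by positivity
  have h9 : 0 ≤ phi n m * ε := by positivity
  have h10 : s * κ / 2 * sqDist m αs α ≤ s * κ / 2 * (2 * sqDist m αs β + phi n m * ε) := by
    gcongr
  nlinarith

/-- Outside an event of small probability, the log-likelihood ratio of every embedding is bounded
above by the negative squared distance to the true tensor, up to a multiple of `φ(n, m) ε`. -/
lemma exists_event_logRatio_le {n m r : ℕ} {Ω : Type*} [MeasurableSpace Ω] {μ : Measure Ω}
    [IsProbabilityMeasure μ] {s R ε : ℝ} (hs : 0 < s) (hs1 : s < 1) (hR : 1 ≤ R) (hr : 1 ≤ r)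
    (hm : 1 ≤ m) (hε : 0 < ε) (hε1 : ε ≤ 1) {αs : Matrix (Fin (n + 1)) (Fin r) ℝ}
    (hαs : ∀ i j, |αs i j| ≤ R) {H : Ω → BoundedHypergraph n m} (hH : IsModel μ s αs H) {N : ℕ}
    (hN : 4 * r * m * R ^ (m + 1) / ε ≤ N) :
    ∃ bad : Set Ω,
      μ bad ≤ ENNReal.ofReal (((N : ℝ) + 1) ^ ((n + 1) * r) * Real.exp (-(phi n m * ε))) ∧
      ∀ ω ∉ bad, ∀ α : Matrix (Fin (n + 1)) (Fin r) ℝ, (∀ i j, |α i j| ≤ R) →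
        logRatio s (H ω) αs α + s * curvature (r * R ^ m) / 2 * sqDist m αs α ≤
          4 * (phi n m * ε) := by
  have hr' : (1 : ℝ) ≤ r := by exact_mod_cast hr
  have hm' : (1 : ℝ) ≤ m := by exact_mod_cast hm
  -- a change of the entries by `δ` changes the tensor by at most `ε / 2` and the loss by at most
  -- `ε`
  set δ : ℝ := ε / (2 * (r * m * R ^ m)) with hδdef
  have hδ : 0 < δ := by positivity
  have hNδ : 2 * R / δ ≤ N := by
    refine le_trans (le_of_eq ?_) hN
    rw [hδdef]; field_simp; ring
  -- the grid matrices need not be admissible: only the bound on their entries matters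
  have hgrid : ∀ (g : Fin (n + 1) → Fin r → Fin (N + 1)) i j, |gridMatrix R δ N g i j| ≤ R :=
    fun g i j => abs_gridPoint_le (by linarith) hδ.le _
  refine ⟨⋃ g : Fin (n + 1) → Fin r → Fin (N + 1), {ω | 2 * (phi n m * ε) ≤
    logRatio s (H ω) αs (gridMatrix R δ N g) +
      s * curvature (r * R ^ m) * sqDist m αs (gridMatrix R δ N g)}, ?_, ?_⟩
  · refine (measure_iUnion_fintype_le _ _).trans ?_
    refine (Finset.sum_le_sum fun g _ =>
      measure_logRatio_ge_le hs hs1 hαs (hgrid g) hH (phi n m * ε)).trans ?_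
    rw [Finset.sum_const, ← ENNReal.ofReal_nsmul]
    refine ENNReal.ofReal_le_ofReal (le_of_eq ?_)
    simp only [Finset.card_univ, Fintype.card_pi, Fintype.card_fin, Finset.prod_const,
      nsmul_eq_mul]
    push_cast
    rw [← pow_mul, mul_comm r]
  · intro ω hω α hα
    simp only [Set.mem_iUnion, Set.mem_ofPred_eq, not_exists, not_le] at hω
    set g : Fin (n + 1) → Fin r → Fin (N + 1) := fun i j => gridIndex R δ N (α i j)
    refine logRatio_add_sqDist_le_of_close hs hs1 hR hr hm hε hε1 (curvature_pos _).le
      (curvature_le_one (by positivity)) hα (hgrid g) (fun i j => ?_) (H ω) (hω g).le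
    exact abs_sub_gridPoint_le hδ hNδ (hα i j)

/-! ### Penalties and the basic inequality -/

lemma J0_nonneg {n r : ℕ} (α : Matrix (Fin (n + 1)) (Fin r) ℝ) : 0 ≤ J0 α := by
  unfold J0; positivity

lemma J1_nonneg {n r : ℕ} (K : ℕ) (α : Matrix (Fin (n + 1)) (Fin r) ℝ) : 0 ≤ J1 K α :=
  Real.iInf_nonneg fun _ => by positivity

/-- Basic inequality: where the uniform likelihood bound holds, a minimizer of the regularized
negative log-likelihood has second penalty of order `ε` and squared tensor distance of order
`φ(n, m) ε / s`. -/
lemma IsEstimator.penalty_and_sqDist_le {n m r : ℕ} {c₀ : ℝ} {K : ℕ} {s lam0 lam1 ε κ : ℝ}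
    {H : BoundedHypergraph n m} {αs α : Matrix (Fin (n + 1)) (Fin r) ℝ} (hφ : 0 < phi n m)
    (hs : 0 < s) (hκ : 0 < κ) (hε : 0 < ε) (hlam0 : 0 < lam0) (hlam1 : 0 < lam1)
    (hα : IsEstimator c₀ K s lam0 lam1 H α) (hαs : IsAdmissible c₀ αs)
    (hpen : penalty K lam0 lam1 αs < 1 / 2 * ε)
    (hlik : logRatio s H αs α + s * κ / 2 * sqDist m αs α ≤ 4 * (phi n m * ε)) :
    lam1 * J1 K α ≤ 5 * ε ∧ sqDist m αs α ≤ 10 / κ * phi n m * (ε / s) := by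
  have hφ' : (0 : ℝ) < phi n m := by exact_mod_cast hφ
  have h1 := hα.2 αs hαs
  have h2 : (phi n m : ℝ) * penalty K lam0 lam1 α ≤
      phi n m * penalty K lam0 lam1 αs + logRatio s H αs α := by
    unfold objective at h1
    rw [logRatio, Finset.sum_sub_distrib]
    have h3 := mul_le_mul_of_nonneg_left h1 hφ'.le
    rw [mul_add, mul_add, ← mul_assoc, ← mul_assoc, mul_one_div_cancel hφ'.ne', one_mul,
      one_mul] at h3
    linarith
  have hsq : 0 ≤ sqDist m αs α := Finset.sum_nonneg fun _ _ => sq_nonneg _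
  have hJ0 := mul_nonneg hlam0.le (J0_nonneg α)
  have hJ1 := mul_nonneg hlam1.le (J1_nonneg K α)
  have h4 : (phi n m : ℝ) * penalty K lam0 lam1 αs ≤ phi n m * (1 / 2 * ε) := by gcongr
  have h5 : penalty K lam0 lam1 α = lam0 * J0 α + lam1 * J1 K α := rfl
  have h6 : 0 ≤ s * κ / 2 * sqDist m αs α := by positivity
  have h7 : (phi n m : ℝ) * (lam0 * J0 α + lam1 * J1 K α) + s * κ / 2 * sqDist m αs α ≤
      phi n m * (5 * ε) := by
    rw [← h5]; nlinarith
  constructor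
  · have h8 : (phi n m : ℝ) * (lam1 * J1 K α) ≤ phi n m * (5 * ε) := by nlinarith
    exact le_of_mul_le_mul_left h8 hφ'
  · have h9 : s * κ / 2 * sqDist m αs α ≤ phi n m * (5 * ε) := by
      have : 0 ≤ (phi n m : ℝ) * (lam0 * J0 α + lam1 * J1 K α) := by positivity
      linarith
    have h10 : 10 / κ * phi n m * (ε / s) = phi n m * (5 * ε) / (s * κ / 2) := by
      field_simp; ring
    rw [h10, le_div_iff₀ (by positivity)]
    linarith

/-! ### Within-cluster variation of the k-means assignment -/

lemma membership_mul_apply {n K r : ℕ} (ψ : Fin n → Fin K) (C : Matrix (Fin (K + 1)) (Fin r) ℝ)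
    (i : Fin (n + 1)) (j : Fin r) : (membership ψ * C) i j = C (extendAssign ψ i) j := by
  simp [Matrix.mul_apply, membership]

lemma extendAssign_castSucc {n K : ℕ} (ψ : Fin n → Fin K) (i : Fin n) :
    extendAssign ψ i.castSucc = (ψ i).castSucc := by
  simp [extendAssign]

lemma frobNorm_sq {ι κ : Type*} [Fintype ι] [Fintype κ] (M : Matrix ι κ ℝ) :
    frobNorm M ^ 2 = ∑ i, ∑ j, M i j ^ 2 :=
  Real.sq_sqrt (Finset.sum_nonneg fun _ _ => Finset.sum_nonneg fun _ _ => sq_nonneg _)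

lemma sum_sq_sub_center_le {n K r : ℕ} (ψ : Fin n → Fin K) (α : Matrix (Fin (n + 1)) (Fin r) ℝ)
    (C : Matrix (Fin (K + 1)) (Fin r) ℝ) :
    ∑ v : Fin n, ∑ j, (α v.castSucc j - C (ψ v).castSucc j) ^ 2 ≤
      frobNorm (α - membership ψ * C) ^ 2 := by
  rw [frobNorm_sq, Fin.sum_univ_castSucc]
  simp only [Matrix.sub_apply, membership_mul_apply, extendAssign_castSucc]
  have : 0 ≤ ∑ j, (α (Fin.last n) j - C (extendAssign ψ (Fin.last n)) j) ^ 2 :=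
    Finset.sum_nonneg fun _ _ => sq_nonneg _
  linarith

lemma frobNorm_sub_membership_le_of_nearest {n K r : ℕ} {ψ : Fin n → Fin K}
    {α : Matrix (Fin (n + 1)) (Fin r) ℝ} {C : Matrix (Fin (K + 1)) (Fin r) ℝ}
    (h : ∀ (i : Fin n) (k : Fin K),
      arrayNorm (α i.castSucc - C (ψ i).castSucc) ≤ arrayNorm (α i.castSucc - C k.castSucc))
    (ψ' : Fin n → Fin K) :
    frobNorm (α - membership ψ * C) ≤ frobNorm (α - membership ψ' * C) := by
  unfold frobNorm
  refine Real.sqrt_le_sqrt ?_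
  rw [Fin.sum_univ_castSucc, Fin.sum_univ_castSucc]
  simp only [Matrix.sub_apply, membership_mul_apply, extendAssign_castSucc]
  refine add_le_add (Finset.sum_le_sum fun i _ => ?_) (le_of_eq ?_)
  · have := h i (ψ' i)
    unfold arrayNorm at this
    rwa [Real.sqrt_le_sqrt_iff (Finset.sum_nonneg fun _ _ => sq_nonneg _)] at this
  · simp [extendAssign]

/-- The k-means assignment attains the second penalty. -/
lemma IsKMeansAssignment.exists_center {n K r : ℕ} (hn : 1 ≤ n) {ψ : Fin n → Fin K}
    {α : Matrix (Fin (n + 1)) (Fin r) ℝ} (h : IsKMeansAssignment α ψ) :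
    ∃ C : Matrix (Fin K) (Fin r) ℝ,
      ∑ v : Fin n, ∑ j, (α v.castSucc j - C (ψ v) j) ^ 2 ≤ n * J1 K α := by
  obtain ⟨C, hC, hnear⟩ := h
  have hn' : (0 : ℝ) < n := by exact_mod_cast hn
  have : Nonempty (Fin n → Fin K) := ⟨ψ⟩
  refine ⟨fun k => C k.castSucc, (sum_sq_sub_center_le ψ α C).trans ?_⟩
  have key : ∀ p : (Fin n → Fin K) × Matrix (Fin (K + 1)) (Fin r) ℝ,
      frobNorm (α - membership ψ * C) ≤ frobNorm (α - membership p.1 * p.2) := fun p =>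
    calc frobNorm (α - membership ψ * C) ≤ ⨅ ψ' : Fin n → Fin K, frobNorm (α - membership ψ' * C) :=
          le_ciInf fun ψ' => frobNorm_sub_membership_le_of_nearest hnear ψ'
      _ ≤ _ := hC p.2
      _ ≤ _ := ciInf_le (Set.finite_range _).bddBelow p.1
  have h2 : (1 / (n : ℝ)) * frobNorm (α - membership ψ * C) ^ 2 ≤ J1 K α := by
    refine le_ciInf fun p => ?_
    have := key p
    have h0 : 0 ≤ frobNorm (α - membership ψ * C) := Real.sqrt_nonneg _
    gcongr
  rw [one_div, inv_mul_le_iff₀ hn'] at h2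
  exact h2

lemma withNullCenter_castSucc {K r : ℕ} (C : Matrix (Fin K) (Fin r) ℝ) (k : Fin K) :
    withNullCenter C k.castSucc = C k := by
  funext j
  simp [withNullCenter]

lemma abs_centers_le {n K r : ℕ} {R : ℝ} (hR : 0 ≤ R) {α : Matrix (Fin (n + 1)) (Fin r) ℝ}
    (hα : ∀ i j, |α i j| ≤ R) (ψ : Fin n → Fin K) (k : Fin K) (j : Fin r) :
    |centers α ψ k j| ≤ R := by
  have h1 : |∑ i ∈ Finset.univ.filter (fun i => ψ i = k), α i.castSucc j| ≤ commSize ψ k * R := by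
    refine (Finset.abs_sum_le_sum_abs _ _).trans ?_
    refine (Finset.sum_le_sum fun i _ => hα i.castSucc j).trans ?_
    simp [commSize]
  simp only [centers, Matrix.of_apply, abs_mul]
  rcases Nat.eq_zero_or_pos (commSize ψ k) with h0 | h0
  · simp [h0, hR]
  · have h0' : (0 : ℝ) < commSize ψ k := by exact_mod_cast h0
    rw [abs_of_pos (by positivity), one_div, inv_mul_le_iff₀ h0']
    exact h1

/-! ### Consequences of the separation and balance of the communities -/

/-- Separated sub-tensors differ by at least `c₂` in some entry. -/
lemma WellSeparated.exists_entry {n r K p : ℕ} {c₂ : ℝ} {α : Matrix (Fin (n + 1)) (Fin r) ℝ}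
    {ψ : Fin n → Fin K} (h : WellSeparated (p + 1) c₂ α ψ) {k k' : Fin K} (hk : k ≠ k') :
    ∃ q : Fin p → Fin K, c₂ ≤ |cpTensor (p + 1) (centers α ψ) (Fin.cons k q) -
      cpTensor (p + 1) (centers α ψ) (Fin.cons k' q)| := by
  by_contra! hcon
  have h1 := h k k' hk
  have hslice : ∀ (T : (Fin (p + 1) → Fin K) → ℝ) (k : Fin K) (q : Fin p → Fin K),
      firstSlice T k q = T (Fin.cons k q) := by
    intro T k q
    unfold firstSlice
    congr 1
    funext l
    refine Fin.cases ?_ (fun l => ?_) l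
    · simp
    · simp
  have hK : (0 : ℝ) < K := by exact_mod_cast Nat.lt_of_le_of_lt (Nat.zero_le _) k.2
  have hpow : ((K : ℝ) ^ ((((p + 1 : ℕ) : ℝ) - 1) / 2)) ^ 2 = (K : ℝ) ^ p := by
    rw [← Real.rpow_natCast, ← Real.rpow_mul hK.le, ← Real.rpow_natCast]
    congr 1
    push_cast
    ring
  have hc : 0 < c₂ := (abs_nonneg _).trans_lt (hcon fun _ => k)
  have hP : 0 < (K : ℝ) ^ ((((p + 1 : ℕ) : ℝ) - 1) / 2) := Real.rpow_pos_of_pos hK _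
  rw [one_div, le_inv_mul_iff₀ hP] at h1
  have h2 := pow_le_pow_left₀ (by positivity) h1 2
  rw [mul_pow, hpow, arrayNorm,
    Real.sq_sqrt (Finset.sum_nonneg fun _ _ => sq_nonneg _)] at h2
  have h3 : ∑ q : Fin (p + 1 - 1) → Fin K,
      ((firstSlice (cpTensor (p + 1) (centers α ψ)) k -
        firstSlice (cpTensor (p + 1) (centers α ψ)) k') q) ^ 2 <
      ∑ _q : Fin p → Fin K, c₂ ^ 2 := by
    refine Finset.sum_lt_sum_of_nonempty ⟨fun _ => k, Finset.mem_univ _⟩ fun q _ => ?_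
    rw [Pi.sub_apply, hslice, hslice, ← sq_abs]
    exact pow_lt_pow_left₀ (hcon q) (abs_nonneg _) two_ne_zero
  rw [Finset.sum_const, nsmul_eq_mul, Finset.card_univ, Fintype.card_fun, Fintype.card_fin,
    Fintype.card_fin] at h3
  push_cast at h3
  linarith

/-- Separation bounds the number of communities: the centers are separated points of a bounded set
in dimension `r`. -/
lemma exists_card_communities_le (p r : ℕ) {R c₂ : ℝ} (hR : 1 ≤ R) (hc₂ : 0 < c₂) (hr : 1 ≤ r) :
    ∃ K₀ : ℕ, ∀ (n K : ℕ) (α : Matrix (Fin (n + 1)) (Fin r) ℝ) (ψ : Fin n → Fin K),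
      (∀ i j, |α i j| ≤ R) → WellSeparated (p + 1) c₂ α ψ → K ≤ K₀ := by
  have hr' : (1 : ℝ) ≤ r := by exact_mod_cast hr
  set L : ℝ := r * (p + 1 : ℕ) * R ^ (p + 1) with hL
  have hL0 : 0 < L := by positivity
  set δ : ℝ := c₂ / (2 * L) with hδ
  have hδ0 : 0 < δ := by positivity
  set N : ℕ := ⌈2 * R / δ⌉₊
  have hN : 2 * R / δ ≤ N := Nat.le_ceil _
  refine ⟨(N + 1) ^ r, fun n K α ψ hα hsep => ?_⟩
  have hC := abs_centers_le (by linarith) hα ψ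
  have hinj : Function.Injective fun (k : Fin K) (j : Fin r) =>
      gridIndex R δ N (centers α ψ k j) := by
    intro k k' hkk
    by_contra hne
    obtain ⟨q, hq⟩ := hsep.exists_entry hne
    have hclose : ∀ j, |centers α ψ k j - centers α ψ k' j| ≤ δ := fun j =>
      (abs_sub_lt_of_gridIndex_eq hδ0 hN (hC k j) (hC k' j) (congrFun hkk j)).le
    have h1 := abs_cpTensor_sub_le hR hδ0.le (centers α ψ) (centers α ψ) (Fin.cons k q)
      (Fin.cons k' q) (fun _ _ => hC _ _) (fun _ _ => hC _ _) (fun l j => by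
        refine Fin.cases ?_ (fun l => ?_) l
        · simpa using hclose j
        · simpa using hδ0.le)
    have h2 : L * δ = c₂ / 2 := by rw [hδ]; field_simp
    rw [← hL, h2] at h1
    linarith
  simpa using Fintype.card_le_of_injective _ hinj

lemma sum_commSize {n K : ℕ} (ψ : Fin n → Fin K) : ∑ k, commSize ψ k = n := by
  have h := Finset.card_eq_sum_card_fiberwise (f := ψ) (s := Finset.univ) (t := Finset.univ)
    (fun _ _ => Finset.mem_coe.2 (Finset.mem_univ _))
  simpa [commSize] using h.symm

lemma BalancedSizes.le_mul_commSize {n K : ℕ} {c₃ : ℝ} {ψ : Fin n → Fin K}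
    (h : BalancedSizes c₃ ψ) (k : Fin K) : (n : ℝ) ≤ K * c₃ * commSize ψ k := by
  have h1 : (n : ℝ) = ∑ k', (commSize ψ k' : ℝ) := by exact_mod_cast (sum_commSize ψ).symm
  rw [h1]
  have h2 : ∀ k' ∈ (Finset.univ : Finset (Fin K)), (commSize ψ k' : ℝ) ≤ c₃ * commSize ψ k :=
    fun k' _ => (div_le_iff₀ (by exact_mod_cast h.1 k)).1 (h.2 k' k)
  refine (Finset.sum_le_sum h2).trans (le_of_eq ?_)
  simp [mul_assoc]

/-! ### From tensor distance to misclassification -/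

open Classical in
/-- Greedy count of systems of distinct representatives: each choice removes at most one element
from each of the later sets. -/
lemma pow_le_card_injective {V : Type*} [Fintype V] (t : ℕ) : ∀ (p : ℕ) (A : Fin p → Finset V),
    (∀ l, t + p ≤ (A l).card) →
      t ^ p ≤ (Finset.univ.filter fun j : Fin p → V =>
        Function.Injective j ∧ ∀ l, j l ∈ A l).card := by
  intro p
  induction p with
  | zero =>
    intro A _
    rw [pow_zero, Nat.one_le_iff_ne_zero, ← Nat.pos_iff_ne_zero, Finset.card_pos]
    exact ⟨Fin.elim0, Finset.mem_filter.2 ⟨Finset.mem_univ _, Function.injective_of_subsingleton _,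
      fun l => l.elim0⟩⟩
  | succ p ih =>
    intro A hA
    set S : V → Finset (Fin p → V) := fun a => Finset.univ.filter fun j =>
      Function.Injective j ∧ ∀ l, j l ∈ (A l.succ).erase a with hS
    have hSc : ∀ a, t ^ p ≤ (S a).card := fun a => ih (fun l => (A l.succ).erase a) fun l => by
      have h1 := hA l.succ
      have h2 := Finset.pred_card_le_card_erase (s := A l.succ) (a := a)
      omega
    have hsig : t ^ (p + 1) ≤ ((A 0).sigma S).card := by
      rw [Finset.card_sigma]
      calc t ^ (p + 1) = t * t ^ p := by ring
        _ ≤ (A 0).card * t ^ p := Nat.mul_le_mul_right _ (by have := hA 0; omega)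
        _ ≤ _ := by
          rw [← smul_eq_mul]
          exact Finset.card_nsmul_le_sum _ _ _ fun a _ => hSc a
    refine hsig.trans (Finset.card_le_card_of_injOn
      (fun x => (Fin.cons x.1 x.2 : Fin (p + 1) → V)) ?_ ?_)
    · rintro ⟨a, j⟩ hx
      simp only [hS, Finset.coe_sigma, Set.mem_sigma_iff, Finset.mem_coe, Finset.mem_filter,
        Finset.mem_univ, true_and, Finset.mem_erase] at hx
      obtain ⟨ha, hj, hjA⟩ := hx
      simp only [Finset.coe_filter, Finset.mem_univ, true_and, Set.mem_ofPred_eq]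
      refine ⟨Fin.cons_injective_iff.2 ⟨?_, hj⟩, fun l => ?_⟩
      · rintro ⟨l, hl⟩
        exact (hjA l).1 hl
      · refine Fin.cases ?_ (fun l => ?_) l
        · simpa using ha
        · simpa using (hjA l).2
    · rintro ⟨a, j⟩ _ ⟨b, k⟩ _ hab
      obtain ⟨h1, h2⟩ := Fin.cons_inj.1 hab
      subst h1 h2
      rfl

/-- If two good vertices with the same estimated label always have the same true label, and every
true community contains a good vertex, then only the bad vertices are misclassified. -/
lemma err_le_card_div {n K : ℕ} {ψs ψh : Fin n → Fin K} (bad : Finset (Fin n))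
    (hgood : ∀ v ∉ bad, ∀ w ∉ bad, ψh v = ψh w → ψs v = ψs w)
    (hrep : ∀ k, ∃ v ∉ bad, ψs v = k) : err ψs ψh ≤ (bad.card : ℝ) / n := by
  choose g hg hgk using hrep
  have hinj : Function.Injective fun k => ψh (g k) := fun k k' h => by
    rw [← hgk k, ← hgk k']
    exact hgood _ (hg k) _ (hg k') h
  -- sending a community to the estimated label of a good member is injective, hence a permutation
  set τ : Equiv.Perm (Fin K) := Equiv.ofBijective _ (Finite.injective_iff_bijective.1 hinj) with hτ
  have hπ : ∀ v ∉ bad, ψs v = τ.symm (ψh v) := by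
    intro v hv
    rw [Equiv.eq_symm_apply]
    obtain ⟨k, hk⟩ := τ.surjective (ψh v)
    have h1 : ψs v = k := by
      rw [← hgk k]
      exact hgood v hv _ (hg k) hk.symm
    rw [h1, hk]
  unfold err
  refine (ciInf_le (Set.finite_range _).bddBelow τ.symm).trans ?_
  rw [one_div, div_eq_inv_mul]
  refine mul_le_mul_of_nonneg_left ?_ (by positivity)
  have h2 : ∀ i ∈ (Finset.univ : Finset (Fin n)),
      (if ψs i ≠ τ.symm (ψh i) then (1 : ℝ) else 0) ≤ if i ∈ bad then 1 else 0 := by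
    intro i _
    by_cases hi : i ∈ bad
    · simp only [hi, if_true]; split_ifs <;> norm_num
    · rw [if_neg (not_not.2 (hπ i hi)), if_neg hi]
  refine (Finset.sum_le_sum h2).trans (le_of_eq ?_)
  simp

open Classical in
/-- The squared distance of two tensors over the tuples of distinct vertices that start at `v`. -/
noncomputable def vertexDist {n r : ℕ} (p : ℕ) (a b : Matrix (Fin n) (Fin r) ℝ) (v : Fin n) : ℝ :=
  ∑ j : Fin p → Fin n with Function.Injective (Fin.cons v j : Fin (p + 1) → Fin n),
    (cpTensor (p + 1) a (Fin.cons v j) - cpTensor (p + 1) b (Fin.cons v j)) ^ 2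

open Classical in
lemma sum_vertexDist {n r : ℕ} (p : ℕ) (a b : Matrix (Fin n) (Fin r) ℝ) :
    ∑ v, vertexDist p a b v = ∑ f : Fin (p + 1) → Fin n with Function.Injective f,
      (cpTensor (p + 1) a f - cpTensor (p + 1) b f) ^ 2 := by
  simp only [vertexDist, Finset.sum_filter]
  rw [← Fintype.sum_prod_type']
  exact Fintype.sum_equiv (Fin.consEquiv fun _ => Fin n) _ _ fun x => rfl

open Classical in
/-- Two vertices of different true communities that are embedded close to the same estimated center
have a large joint tensor distance: replacing one by the other changes the true tensor by about
`c₂` on a whole block of tuples, but hardly changes the estimated one. -/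
lemma vertexDist_add_ge {n r K p t : ℕ} {R κ c₂ : ℝ} (hR : 1 ≤ R) (hκ : 0 ≤ κ)
    (hκc : 4 * (r * (p + 1 : ℕ) * R ^ (p + 1) * κ) ≤ c₂ / 2)
    {a b : Matrix (Fin n) (Fin r) ℝ} {A B : Matrix (Fin K) (Fin r) ℝ} {ψh ψs : Fin n → Fin K}
    (ha : ∀ v j, |a v j| ≤ R) (hb : ∀ v j, |b v j| ≤ R) (hB : ∀ k j, |B k j| ≤ R)
    (hsep : ∀ k k', k ≠ k' → ∃ q : Fin p → Fin K,
      c₂ ≤ |cpTensor (p + 1) B (Fin.cons k q) - cpTensor (p + 1) B (Fin.cons k' q)|)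
    (hc₂ : 0 < c₂) {bad : Finset (Fin n)}
    (hbada : ∀ v ∉ bad, ∀ j, |a v j - A (ψh v) j| ≤ κ)
    (hbadb : ∀ v ∉ bad, ∀ j, |b v j - B (ψs v) j| ≤ κ)
    (hsize : ∀ k, t + p + 2 + bad.card ≤ commSize ψs k)
    {v w : Fin n} (hv : v ∉ bad) (hw : w ∉ bad) (hvw : ψh v = ψh w) (hne : ψs v ≠ ψs w) :
    (t : ℝ) ^ p * (c₂ ^ 2 / 8) ≤ vertexDist p a b v + vertexDist p a b w := by
  obtain ⟨q, hq⟩ := hsep _ _ hne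
  set L : ℝ := r * (p + 1 : ℕ) * R ^ (p + 1) with hL
  have hL0 : 0 ≤ L := by positivity
  -- the block: good vertices of the communities `q l`, other than `v` and `w`
  set S : Fin p → Finset (Fin n) := fun l =>
    (((Finset.univ.filter fun u => ψs u = q l) \ bad).erase v).erase w with hS
  have hScard : ∀ l, t + p ≤ (S l).card := fun l => by
    have h1 := hsize (q l)
    unfold commSize at h1
    have h2 := Finset.le_card_sdiff bad (Finset.univ.filter fun u => ψs u = q l)
    have h3 := Finset.pred_card_le_card_erase
      (s := (Finset.univ.filter fun u => ψs u = q l) \ bad) (a := v)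
    have h4 := Finset.pred_card_le_card_erase
      (s := ((Finset.univ.filter fun u => ψs u = q l) \ bad).erase v) (a := w)
    simp only [hS]
    omega
  set J := Finset.univ.filter fun j : Fin p → Fin n =>
    Function.Injective j ∧ ∀ l, j l ∈ S l with hJ
  have hJcard : (t : ℝ) ^ p ≤ J.card := by
    have h := pow_le_card_injective t p S hScard
    have h' : t ^ p ≤ J.card := by convert h
    exact_mod_cast h'
  set D : Fin n → (Fin p → Fin n) → ℝ := fun u j =>
    (cpTensor (p + 1) a (Fin.cons u j) - cpTensor (p + 1) b (Fin.cons u j)) ^ 2 with hD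
  have hJmem : ∀ j ∈ J, Function.Injective j ∧
      ∀ l, j l ≠ w ∧ j l ≠ v ∧ ψs (j l) = q l ∧ j l ∉ bad := by
    intro j hj
    obtain ⟨h1, h2⟩ := (Finset.mem_filter.1 hj).2
    refine ⟨h1, fun l => ?_⟩
    have h3 := h2 l
    simp only [hS, Finset.mem_erase, Finset.mem_sdiff, Finset.mem_filter, Finset.mem_univ,
      true_and] at h3
    tauto
  have hsub : ∀ u, (∀ j ∈ J, ∀ l, j l ≠ u) → ∑ j ∈ J, D u j ≤ vertexDist p a b u := by
    intro u hu
    refine Finset.sum_le_sum_of_subset_of_nonneg (fun j hj => ?_) fun _ _ _ => sq_nonneg _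
    refine Finset.mem_filter.2 ⟨Finset.mem_univ _, Fin.cons_injective_iff.2 ⟨?_, (hJmem j hj).1⟩⟩
    rintro ⟨l, hl⟩
    exact hu j hj l hl
  have hcons : ∀ {ι ι' : Type} (M : Matrix ι (Fin r) ℝ) (M' : Matrix ι' (Fin r) ℝ)
      (x : ι) (x' : ι') (y : Fin p → ι) (y' : Fin p → ι') (δ : ℝ), 0 ≤ δ →
      (∀ i j, |M i j| ≤ R) → (∀ i j, |M' i j| ≤ R) → (∀ j, |M x j - M' x' j| ≤ δ) →
      (∀ l j, |M (y l) j - M' (y' l) j| ≤ δ) →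
      |cpTensor (p + 1) M (Fin.cons x y) - cpTensor (p + 1) M' (Fin.cons x' y')| ≤ L * δ := by
    intro ι ι' M M' x x' y y' δ hδ hM hM' h0 hl
    refine abs_cpTensor_sub_le hR hδ M M' _ _ (fun _ _ => hM _ _) (fun _ _ => hM' _ _) fun l j => ?_
    refine Fin.cases ?_ (fun l => ?_) l
    · simpa using h0 j
    · simpa using hl l j
  have hterm : ∀ j ∈ J, c₂ ^ 2 / 8 ≤ D v j + D w j := by
    intro j hj
    have hj' := (hJmem j hj).2
    have hblock : ∀ l i, |b (j l) i - B (q l) i| ≤ κ := fun l i => by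
      rw [← (hj' l).2.2.1]
      exact hbadb _ (hj' l).2.2.2 i
    have e1 := hcons b B v (ψs v) j q κ hκ hb hB (hbadb v hv) hblock
    have e2 := hcons b B w (ψs w) j q κ hκ hb hB (hbadb w hw) hblock
    have e3 := hcons a a v w j j (2 * κ) (by positivity) ha ha (fun i => by
      have h1 := abs_le.1 (hbada v hv i)
      have h2 := abs_le.1 (hbada w hw i)
      rw [hvw] at h1
      rw [abs_le]
      constructor <;> linarith) (fun l i => by simpa using hκ)
    simp only [hD]
    -- `e1`, `e2`: the true slices are close to those of the centers; `e3`: the estimated slices of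
    -- `v` and `w` are close to each other
    set X := cpTensor (p + 1) a (Fin.cons v j) - cpTensor (p + 1) b (Fin.cons v j) with hX
    set Y := cpTensor (p + 1) a (Fin.cons w j) - cpTensor (p + 1) b (Fin.cons w j) with hY
    have e4 : c₂ / 2 ≤ |X - Y| := by
      rw [abs_le] at e1 e2 e3
      rcases le_abs.1 hq with h | h
      · refine le_trans ?_ (neg_le_abs _)
        linarith [e1.1, e2.2, e3.1, e3.2, e1.2, e2.1]
      · refine le_trans ?_ (le_abs_self _)
        linarith [e1.1, e2.2, e3.1, e3.2, e1.2, e2.1]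
    have e5 := pow_le_pow_left₀ (by positivity) e4 2
    rw [sq_abs] at e5
    nlinarith [sq_nonneg (X + Y)]
  calc (t : ℝ) ^ p * (c₂ ^ 2 / 8) ≤ J.card * (c₂ ^ 2 / 8) := by gcongr
    _ = ∑ _j ∈ J, c₂ ^ 2 / 8 := by simp
    _ ≤ ∑ j ∈ J, (D v j + D w j) := Finset.sum_le_sum hterm
    _ = ∑ j ∈ J, D v j + ∑ j ∈ J, D w j := Finset.sum_add_distrib
    _ ≤ _ := add_le_add (hsub v fun j hj l => ((hJmem j hj).2 l).2.1)
        (hsub w fun j hj l => ((hJmem j hj).2 l).1)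

lemma card_filter_le_div {ι : Type*} [Fintype ι] (f : ι → ℝ) (hf : ∀ i, 0 ≤ f i) {c T : ℝ}
    (hc : 0 < c) (hT : ∑ i, f i ≤ T) :
    ((Finset.univ.filter fun i => c ≤ f i).card : ℝ) ≤ T / c := by
  rw [le_div_iff₀ hc]
  refine le_trans ?_ hT
  calc ((Finset.univ.filter fun i => c ≤ f i).card : ℝ) * c
      = ∑ _i ∈ Finset.univ.filter fun i => c ≤ f i, c := by simp
    _ ≤ ∑ i ∈ Finset.univ.filter fun i => c ≤ f i, f i :=
        Finset.sum_le_sum fun i hi => (Finset.mem_filter.1 hi).2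
    _ ≤ ∑ i, f i := Finset.sum_le_sum_of_subset_of_nonneg (Finset.filter_subset _ _)
        fun i _ _ => hf i

lemma abs_le_of_not_sq_le_sum {r : ℕ} {κ : ℝ} (hκ : 0 ≤ κ) (x : Fin r → ℝ)
    (h : ¬ κ ^ 2 ≤ ∑ j, x j ^ 2) (j : Fin r) : |x j| ≤ κ := by
  refine abs_le_of_sq_le_sq ?_ hκ
  have := Finset.single_le_sum (f := fun j => x j ^ 2) (fun _ _ => sq_nonneg _) (Finset.mem_univ j)
  linarith

open Classical in
/-- The misclassification error is at most of the order `η` of the normalized tensor distance and of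
the normalized variation of both embeddings around their centers. -/
lemma exists_err_le_mul (p r : ℕ) {R c₂ a₀ Q : ℝ} (hR : 1 ≤ R) (hr : 1 ≤ r) (hc₂ : 0 < c₂)
    (ha₀ : 0 < a₀) (hQ : 0 < Q) :
    ∃ C η₀ n₀ : ℝ, 0 < C ∧ 0 < η₀ ∧ ∀ (n K : ℕ) (η : ℝ) (a b : Matrix (Fin n) (Fin r) ℝ)
      (A B : Matrix (Fin K) (Fin r) ℝ) (ψh ψs : Fin n → Fin K),
      n₀ ≤ n → η ≤ η₀ → (∀ v j, |a v j| ≤ R) → (∀ v j, |b v j| ≤ R) → (∀ k j, |B k j| ≤ R) →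
      (∀ k k', k ≠ k' → ∃ q : Fin p → Fin K,
        c₂ ≤ |cpTensor (p + 1) B (Fin.cons k q) - cpTensor (p + 1) B (Fin.cons k' q)|) →
      (∀ k, a₀ * n ≤ commSize ψs k) →
      (∑ f : Fin (p + 1) → Fin n with Function.Injective f,
        (cpTensor (p + 1) a f - cpTensor (p + 1) b f) ^ 2 ≤ Q * n ^ (p + 1) * η) →
      (∑ v, ∑ j, (a v j - A (ψh v) j) ^ 2 ≤ Q * n * η) →
      (∑ v, ∑ j, (b v j - B (ψs v) j) ^ 2 ≤ Q * n * η) →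
      err ψs ψh ≤ C * η := by
  have hr' : (1 : ℝ) ≤ r := by exact_mod_cast hr
  set L : ℝ := r * (p + 1 : ℕ) * R ^ (p + 1) with hL
  have hL0 : 0 < L := by positivity
  -- four perturbations by at most `L * κ` cost half of the separation `c₂`
  set κ : ℝ := c₂ / (8 * L) with hκ
  have hκ0 : 0 < κ := by positivity
  set e : ℝ := (a₀ / 8) ^ p * (c₂ ^ 2 / 16) with he
  have he0 : 0 < e := by positivity
  set C : ℝ := Q / e + 2 * (Q / κ ^ 2) with hC
  have hC0 : 0 < C := by positivity
  refine ⟨C, a₀ / (4 * C), max 1 (2 * (p + 3) / a₀), hC0, by positivity, ?_⟩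
  intro n K η a b A B ψh ψs hn hη ha hb hB hsep hsize hE hda hdb
  have hn1 : (1 : ℝ) ≤ n := (le_max_left _ _).trans hn
  have hn2 : 2 * (p + 3) ≤ a₀ * n := by
    have := (le_max_right _ _).trans hn
    rwa [div_le_iff₀ ha₀, mul_comm _ a₀] at this
  have hn0 : (0 : ℝ) < n := by linarith
  -- by Markov's inequality each of the three kinds of bad vertices is rare
  set bE := Finset.univ.filter fun v => e * n ^ p ≤ vertexDist p a b v with hbE
  set ba := Finset.univ.filter fun v => κ ^ 2 ≤ ∑ j, (a v j - A (ψh v) j) ^ 2 with hba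
  set bb := Finset.univ.filter fun v => κ ^ 2 ≤ ∑ j, (b v j - B (ψs v) j) ^ 2 with hbb
  set bad := bE ∪ (ba ∪ bb) with hbad
  have hcard : (bad.card : ℝ) ≤ C * η * n := by
    have h1 : (bE.card : ℝ) ≤ Q * n ^ (p + 1) * η / (e * n ^ p) :=
      card_filter_le_div _ (fun v => Finset.sum_nonneg fun _ _ => sq_nonneg _) (by positivity)
        ((sum_vertexDist p a b).trans_le hE)
    have h2 : (ba.card : ℝ) ≤ Q * n * η / κ ^ 2 :=
      card_filter_le_div _ (fun v => Finset.sum_nonneg fun _ _ => sq_nonneg _) (by positivity) hda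
    have h3 : (bb.card : ℝ) ≤ Q * n * η / κ ^ 2 :=
      card_filter_le_div _ (fun v => Finset.sum_nonneg fun _ _ => sq_nonneg _) (by positivity) hdb
    have h4 : (bad.card : ℝ) ≤ bE.card + (ba.card + bb.card) := by
      have h5 := Finset.card_union_le bE (ba ∪ bb)
      have h6 := Finset.card_union_le ba bb
      exact_mod_cast h5.trans (by omega)
    have h7 : Q * n ^ (p + 1) * η / (e * n ^ p) + 2 * (Q * n * η / κ ^ 2) = C * η * n := by
      rw [hC]; field_simp; ring
    linarith
  have hCη : C * η * n ≤ a₀ / 4 * n := by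
    refine mul_le_mul_of_nonneg_right ?_ hn0.le
    rw [le_div_iff₀ (by positivity)] at hη
    linarith
  -- `t` is small enough for every community to keep `t + p` vertices without the bad ones and two
  -- more
  set t : ℕ := ⌈a₀ / 8 * n⌉₊ with ht
  have ht1 : a₀ / 8 * n ≤ t := Nat.le_ceil _
  have ht2 : (t : ℝ) < a₀ / 8 * n + 1 := Nat.ceil_lt_add_one (by positivity)
  have hblock : ∀ k, t + p + 2 + bad.card ≤ commSize ψs k := fun k => by
    have h1 := hsize k
    have h2 : (t : ℝ) + p + 2 + bad.card ≤ commSize ψs k := by nlinarith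
    exact_mod_cast h2
  have hnot : ∀ v ∉ bad, vertexDist p a b v < e * n ^ p ∧
      (∀ j, |a v j - A (ψh v) j| ≤ κ) ∧ ∀ j, |b v j - B (ψs v) j| ≤ κ := by
    intro v hv
    simp only [hbad, hbE, hba, hbb, Finset.mem_union, Finset.mem_filter, Finset.mem_univ, true_and,
      not_or] at hv
    exact ⟨not_le.1 hv.1, abs_le_of_not_sq_le_sum hκ0.le _ hv.2.1,
      abs_le_of_not_sq_le_sum hκ0.le _ hv.2.2⟩
  refine (err_le_card_div bad ?_ ?_).trans ?_
  · intro v hv w hw hvw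
    by_contra hne
    have h1 := vertexDist_add_ge hR hκ0.le (by rw [← hL, hκ]; field_simp; norm_num) ha hb hB hsep
      hc₂ (fun v hv => (hnot v hv).2.1) (fun v hv => (hnot v hv).2.2) hblock hv hw hvw hne
    have h2 := (hnot v hv).1
    have h3 := (hnot w hw).1
    have h4 : (a₀ / 8 * n) ^ p ≤ (t : ℝ) ^ p := pow_le_pow_left₀ (by positivity) ht1 p
    have h5 : 2 * (e * n ^ p) = (a₀ / 8 * n) ^ p * (c₂ ^ 2 / 8) := by rw [he, mul_pow]; ring
    have h6 : (a₀ / 8 * n) ^ p * (c₂ ^ 2 / 8) ≤ (t : ℝ) ^ p * (c₂ ^ 2 / 8) := by gcongr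
    linarith
  · intro k
    have h1 : bad.card < (Finset.univ.filter fun v => ψs v = k).card := by
      have := hblock k
      unfold commSize at this
      omega
    obtain ⟨v, hv, hvb⟩ := Finset.exists_mem_notMem_of_card_lt_card h1
    exact ⟨v, hvb, (Finset.mem_filter.1 hv).2⟩
  · rw [div_le_iff₀ hn0]
    exact hcard

/-! ### Asymptotics -/

/-- Under the rate condition the entropy of the grid is at most half of `φ(n, m) ε`, so that the
union bound over the grid is exponentially small. -/
lemma grid_union_bound_le {n m r N : ℕ} {D ε : ℝ} (hr : 1 ≤ r) (hn : 1 ≤ n) (hφ : 0 < phi n m)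
    (hD : 0 ≤ D) (hε : 0 < ε) (hεD : ε ≤ 1 / (D + 3)) (hN : (N : ℝ) ≤ D / ε + 1)
    (hrate : (n : ℝ) * (phi n m : ℝ)⁻¹ * ε⁻¹ * Real.log (ε ^ (-(1 / 2) : ℝ)) ≤ 1 / (16 * r)) :
    ((N : ℝ) + 1) ^ ((n + 1) * r) * Real.exp (-(phi n m * ε)) ≤ Real.exp (-n) := by
  have hφ' : (0 : ℝ) < phi n m := by exact_mod_cast hφ
  have hr' : (1 : ℝ) ≤ r := by exact_mod_cast hr
  have hn' : (1 : ℝ) ≤ n := by exact_mod_cast hn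
  have hεD' : ε * (D + 3) ≤ 1 := by rwa [le_div_iff₀ (by positivity)] at hεD
  have hε3 : ε * 3 ≤ 1 := by nlinarith
  set l := -Real.log ε with hl
  have hl1 : 1 ≤ l := by
    have h1 : ε ≤ Real.exp (-1) := by
      have h2 : Real.exp 1 ≤ 3 := by linarith [Real.exp_one_lt_d9]
      rw [Real.exp_neg, ← one_div, le_div_iff₀ (Real.exp_pos _)]
      nlinarith
    have h3 := Real.log_le_log hε h1
    rw [Real.log_exp] at h3
    linarith
  have hlog : Real.log (ε ^ (-(1 / 2) : ℝ)) = l / 2 := by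
    rw [Real.log_rpow hε, hl]; ring
  have hent : 8 * n * r * l ≤ phi n m * ε := by
    rw [hlog] at hrate
    have h1 : (n : ℝ) * (phi n m : ℝ)⁻¹ * ε⁻¹ * (l / 2) = (n * l / 2) / (phi n m * ε) := by
      field_simp
    rw [h1, div_le_div_iff₀ (by positivity) (by positivity)] at hrate
    nlinarith
  have hN2 : (N : ℝ) + 1 ≤ Real.exp (2 * l) := by
    have h1 : Real.exp (2 * l) = 1 / (ε * ε) := by
      rw [two_mul, Real.exp_add, hl, Real.exp_neg, Real.exp_log hε]
      field_simp
    rw [h1, le_div_iff₀ (by positivity)]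
    have h2 : (N : ℝ) * ε ≤ D + ε := by
      have := mul_le_mul_of_nonneg_right hN hε.le
      rwa [add_mul, div_mul_cancel₀ _ hε.ne', one_mul] at this
    nlinarith
  have hpow : ((N : ℝ) + 1) ^ ((n + 1) * r) ≤ Real.exp (4 * n * r * l) := by
    calc ((N : ℝ) + 1) ^ ((n + 1) * r) ≤ Real.exp (2 * l) ^ ((n + 1) * r) :=
          pow_le_pow_left₀ (by positivity) hN2 _
      _ = Real.exp (((n : ℝ) + 1) * r * (2 * l)) := by
          rw [← Real.exp_nat_mul]; push_cast; rfl
      _ ≤ Real.exp (4 * n * r * l) := by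
          rw [Real.exp_le_exp]
          have : 0 ≤ r * l := by positivity
          nlinarith
  calc ((N : ℝ) + 1) ^ ((n + 1) * r) * Real.exp (-(phi n m * ε))
      ≤ Real.exp (4 * n * r * l) * Real.exp (-(phi n m * ε)) := by gcongr
    _ = Real.exp (4 * n * r * l - phi n m * ε) := by rw [← Real.exp_add]; rfl
    _ ≤ Real.exp (-n) := by
        rw [Real.exp_le_exp]
        have h1 : 1 ≤ r * l := by nlinarith
        have h2 : (n : ℝ) * 1 ≤ n * (r * l) := by gcongr
        nlinarith

/-- Since there is at least one community, the condition on the number of communities forces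
`ε / s → 0`. -/
lemma eventually_div_le_of_isLittleO {s ε : ℕ → ℝ} {K : ℕ → ℕ} (hs : ∀ n, 0 < s n)
    (hε : ∀ n, 0 < ε n) (hK1 : ∀ᶠ n in atTop, 1 ≤ K n)
    (hK : (fun n : ℕ => (K n : ℝ)) =o[atTop] fun n : ℕ => √(s n / ε n)) {η : ℝ} (hη : 0 < η) :
    ∀ᶠ n in atTop, ε n / s n ≤ η := by
  filter_upwards [hK1, hK.def (Real.sqrt_pos.2 hη)] with n h1 h2
  have h3 : (1 : ℝ) ≤ K n := by exact_mod_cast h1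
  rw [Real.norm_of_nonneg (by positivity), Real.norm_of_nonneg (Real.sqrt_nonneg _),
    ← Real.sqrt_mul hη.le] at h2
  have h4 := Real.one_le_sqrt.1 (h3.trans h2)
  rw [← mul_div_assoc, le_div_iff₀ (hε n)] at h4
  rw [div_le_iff₀ (hs n)]
  linarith

/-- The condition on the tuning parameter in the form `λ₁ ε ≥ c s²`: as `s` stays away from `1`, the
logarithm is bounded below. -/
lemma exists_lam1_lower_bound {s ε lam1 : ℕ → ℝ} {sbar : ℝ} (hsbar : sbar < 1)
    (hs : ∀ n, 0 < s n) (hs1 : ∀ n, s n ≤ sbar)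
    (hlim : ∃ L : EReal, 0 < L ∧ Tendsto (fun n : ℕ =>
      ((lam1 n * ε n * (s n ^ 2)⁻¹ * (Real.log (s n)⁻¹)⁻¹ : ℝ) : EReal)) atTop (𝓝 L)) :
    ∃ c : ℝ, 0 < c ∧ ∀ᶠ n in atTop, c * s n ^ 2 ≤ lam1 n * ε n := by
  obtain ⟨L, hL, hT⟩ := hlim
  obtain ⟨x, hx0, hxL⟩ := EReal.lt_iff_exists_real_btwn.1 hL
  have hx : 0 < x := by exact_mod_cast hx0
  have hsbar0 : 0 < sbar := (hs 0).trans_le (hs1 0)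
  have hl : 0 < Real.log sbar⁻¹ := Real.log_pos ((one_lt_inv₀ hsbar0).2 hsbar)
  refine ⟨x * Real.log sbar⁻¹, by positivity, ?_⟩
  filter_upwards [hT.eventually (lt_mem_nhds hxL)] with n hn
  have hn' : x < lam1 n * ε n * (s n ^ 2)⁻¹ * (Real.log (s n)⁻¹)⁻¹ := by exact_mod_cast hn
  have hls : Real.log sbar⁻¹ ≤ Real.log (s n)⁻¹ :=
    Real.log_le_log (by positivity) (inv_anti₀ (hs n) (hs1 n))
  have hs2 : 0 < s n ^ 2 := pow_pos (hs n) 2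
  rw [← div_eq_mul_inv, ← div_eq_mul_inv, lt_div_iff₀ (hl.trans_le hls), lt_div_iff₀ hs2] at hn'
  refine le_trans ?_ hn'.le
  gcongr

/-- A quantity `J` with `λ₁ J = O(ε)` is `O((ε / s)²)`, hence `O(ε / s)`. -/
lemma le_mul_of_lam1_mul_le {lam1 ε s J c C : ℝ} (hc : 0 < c) (hC : 0 ≤ C) (hs : 0 < s)
    (hε : 0 < ε) (hlam : c * s ^ 2 ≤ lam1 * ε) (hJ0 : 0 ≤ J) (hJ : lam1 * J ≤ C * ε)
    (hη : ε / s ≤ 1) : J ≤ C / c * (ε / s) := by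
  have h1 : c * s ^ 2 * J ≤ C * ε ^ 2 := by nlinarith
  have h2 : J ≤ C / c * (ε / s) ^ 2 := by
    have h3 : C / c * (ε / s) ^ 2 = C * ε ^ 2 / (c * s ^ 2) := by field_simp
    rw [h3, le_div_iff₀ (by positivity)]
    linarith
  have h4 : (ε / s) ^ 2 ≤ ε / s := by
    have : 0 < ε / s := by positivity
    nlinarith
  exact h2.trans (mul_le_mul_of_nonneg_left h4 (by positivity))

lemma err_nonneg {n K : ℕ} (ψ ψ' : Fin n → Fin K) : 0 ≤ err ψ ψ' :=
  Real.iInf_nonneg fun _ => mul_nonneg (by positivity)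
    (Finset.sum_nonneg fun _ _ => by split_ifs <;> norm_num)

end HEM

theorem theorem2
    -- order of the hypergraphs, embedding dimension, and constants
    (m r : ℕ) (hm : 2 ≤ m) (hr : 2 ≤ r)
    (c₀ c₂ c₃ sbar : ℝ) (hc₀ : 0 < c₀) (hc₂ : 0 < c₂) (hsbar : sbar < 1)
    -- sparsity factors, rates, tuning parameters, numbers of communities
    (s ε lam0 lam1 : ℕ → ℝ) (K : ℕ → ℕ)
    (hs : ∀ n, 0 < s n) (hs1 : ∀ n, s n ≤ sbar) (hε : ∀ n, 0 < ε n)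
    (hlam0 : ∀ n, 0 < lam0 n) (hlam1 : ∀ n, 0 < lam1 n)
    -- true embeddings and true community assignments
    (αs : ∀ n, Matrix (Fin (n + 1)) (Fin r) ℝ) (hαs : ∀ n, IsAdmissible c₀ (αs n))
    (ψs : ∀ n, Fin n → Fin (K n))
    -- the observed random hypergraphs
    (Ω : ℕ → Type*) [∀ n, MeasurableSpace (Ω n)]
    (μ : ∀ n, Measure (Ω n)) [∀ n, IsProbabilityMeasure (μ n)]
    (H : ∀ n, Ω n → BoundedHypergraph n m) (hH : ∀ n, IsModel (μ n) (s n) (αs n) (H n))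
    -- conditions on the true embedding and the rate
    (hpen : ∀ᶠ n in atTop, penalty (K n) (lam0 n) (lam1 n) (αs n) < 1 / 2 * ε n)
    (hrate : Tendsto (fun n : ℕ =>
      (n : ℝ) * (phi n m : ℝ)⁻¹ * (ε n)⁻¹ * Real.log (ε n ^ (-(1 / 2) : ℝ))) atTop (𝓝 0))
    -- the true communities are those encoded in the true embedding
    (hcomm : (fun n : ℕ => lam1 n * ((1 / (n : ℝ)) * frobNorm (αs n -
      membership (ψs n) * withNullCenter (centers (αs n) (ψs n))) ^ 2)) =O[atTop] ε)
    -- separated and balanced communities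
    (hA : ∀ᶠ n in atTop, WellSeparated m c₂ (αs n) (ψs n))
    (hB : ∀ᶠ n in atTop, BalancedSizes c₃ (ψs n))
    -- conditions on the tuning parameter and on the number of communities
    (hlim : ∃ L : EReal, 0 < L ∧ Tendsto (fun n : ℕ =>
      ((lam1 n * ε n * (s n ^ 2)⁻¹ * (Real.log (s n)⁻¹)⁻¹ : ℝ) : EReal)) atTop (𝓝 L))
    (hK : (fun n : ℕ => (K n : ℝ)) =o[atTop] fun n : ℕ => √(s n / ε n))
    -- the estimators
    (αh : ∀ n, Ω n → Matrix (Fin (n + 1)) (Fin r) ℝ)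
    (hαh : ∀ n ω, IsEstimator c₀ (K n) (s n) (lam0 n) (lam1 n) (H n ω) (αh n ω))
    (ψh : ∀ n, Ω n → Fin n → Fin (K n))
    (hψh : ∀ n ω, IsKMeansAssignment (αh n ω) (ψh n ω)) :
    IsBigOInProb μ (fun n ω => err (ψs n) (ψh n ω)) (fun n => (K n : ℝ) * ε n / s n) := by
  obtain ⟨p, rfl⟩ : ∃ p, m = p + 1 := ⟨m - 1, by omega⟩
  have hr1 : 1 ≤ r := by omega
  have hr' : (1 : ℝ) ≤ r := by exact_mod_cast hr1
  set R := max c₀ 1 with hRdef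
  have hR : 1 ≤ R := le_max_right _ _
  have hαsR : ∀ n i j, |αs n i j| ≤ R := fun n => (hαs n).abs_le
  set κ := curvature (r * R ^ (p + 1)) with hκdef
  have hκ : 0 < κ := curvature_pos _
  obtain ⟨c, hc, hlam⟩ := exists_lam1_lower_bound hsbar hs hs1 hlim
  obtain ⟨C₁, hC₁, hC₁le⟩ := hcomm.exists_pos
  rw [IsBigOWith] at hC₁le
  obtain ⟨K₀, hK₀⟩ := exists_card_communities_le p r hR hc₂ hr1
  -- every community has at least `a₀ n` members
  set a₀ : ℝ := 1 / ((K₀ + 1) * max c₃ 1) with ha₀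
  have hc₃ : 1 ≤ max c₃ 1 := le_max_right _ _
  have ha₀pos : 0 < a₀ := by positivity
  set Q₁ : ℝ := (p + 1).factorial * (10 / κ * (p + 1 : ℕ)) with hQ₁
  set Q : ℝ := Q₁ + 5 / c + C₁ / c with hQ
  have hQ₁0 : 0 < Q₁ := by positivity
  have hQ0 : 0 < Q := by positivity
  obtain ⟨C, η₀, n₀, hC, hη₀, herr⟩ := exists_err_le_mul p r hR hr1 hc₂ ha₀pos hQ0
  set D : ℝ := 4 * r * (p + 1 : ℕ) * R ^ (p + 1 + 1) with hD
  have hD0 : 0 ≤ D := by positivity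
  have hK1 : ∀ᶠ n in atTop, 1 ≤ K n := by
    filter_upwards [eventually_ge_atTop 1] with n hn
    exact Nat.one_le_iff_ne_zero.2 fun h0 => (Fin.cast h0 (ψs n ⟨0, hn⟩)).elim0
  have hη := fun η (h : 0 < η) => eventually_div_le_of_isLittleO hs hε hK1 hK (η := η) h
  intro δ hδ
  refine ⟨C, hC, ?_⟩
  filter_upwards [hpen, hA, hB, hK1, hlam, hC₁le, hη η₀ hη₀, hη 1 one_pos,
    hη (1 / (D + 3)) (by positivity), hrate.eventually_le_const (show 0 < 1 / (16 * (r : ℝ)) by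
      positivity), eventually_ge_atTop 1, tendsto_natCast_atTop_atTop.eventually_ge_atTop n₀,
    tendsto_natCast_atTop_atTop.eventually_ge_atTop (-Real.log δ)]
    with n hpen hA hB hK1 hlam hcomm hη₀ hη1 hηD hrate hn hn₀ hnδ
  have hs1' : s n < 1 := (hs1 n).trans_lt hsbar
  have hsn := hs n
  have hεn := hε n
  have hn' : (0 : ℝ) < n := by exact_mod_cast hn
  have hη0 : 0 < ε n / s n := by positivity
  have hεη : ε n ≤ ε n / s n := by
    rw [le_div_iff₀ hsn]; nlinarith
  have hφ : 0 < phi n (p + 1) := lt_of_lt_of_le hn (le_phi n (by omega))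
  obtain ⟨bad, hbad, hgood⟩ := exists_event_logRatio_le (μ := μ n) hsn hs1' hR hr1
    (Nat.le_add_left 1 p) hεn (hεη.trans hη1) (hαsR n) (hH n) (N := ⌈D / ε n⌉₊) (Nat.le_ceil _)
  -- the event need not be measurable: it is contained in the union of the grid events
  refine (measure_mono (t := bad) fun ω hω => ?_).trans (hbad.trans (ENNReal.ofReal_le_ofReal ?_))
  · by_contra hωbad
    have hαhR : ∀ i j, |αh n ω i j| ≤ R := (hαh n ω).1.abs_le
    obtain ⟨hJ1, hsq⟩ := (hαh n ω).penalty_and_sqDist_le hφ hsn hκ hεn (hlam0 n) (hlam1 n)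
      (hαs n) hpen (hgood ω hωbad (αh n ω) hαhR)
    obtain ⟨Ch, hCh⟩ := (hψh n ω).exists_center hn
    have hJ1' := le_mul_of_lam1_mul_le hc (by norm_num) hsn hεn hlam (J1_nonneg _ _) hJ1 hη1
    have hW0 : 0 ≤ (1 / (n : ℝ)) * frobNorm (αs n -
        membership (ψs n) * withNullCenter (centers (αs n) (ψs n))) ^ 2 := by positivity
    rw [Real.norm_of_nonneg (mul_nonneg (hlam1 n).le hW0), Real.norm_of_nonneg hεn.le] at hcomm
    have hW := le_mul_of_lam1_mul_le hc hC₁.le hsn hεn hlam hW0 hcomm hη1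
    rw [one_div, inv_mul_le_iff₀ hn'] at hW
    have hkey := herr n (K n) (ε n / s n) (fun v => αh n ω v.castSucc) (fun v => αs n v.castSucc)
      Ch (centers (αs n) (ψs n)) (ψh n ω) (ψs n) hn₀ hη₀ (fun v j => hαhR _ _)
      (fun v j => hαsR n _ _) (abs_centers_le (by linarith) (hαsR n) (ψs n))
      (fun k k' hk => hA.exists_entry hk) ?_ ?_ ?_ ?_
    · -- `n ≥ 1` gives `K ≥ 1`, so a bound of order `ε / s` is enough
      have hb : 0 ≤ (K n : ℝ) * ε n / s n := by positivity
      have hKη : ε n / s n ≤ (K n : ℝ) * ε n / s n := by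
        rw [mul_div_assoc]
        exact le_mul_of_one_le_left hη0.le (by exact_mod_cast hK1)
      rw [Set.mem_ofPred_eq, abs_of_nonneg hb, abs_of_nonneg (err_nonneg _ _)] at hω
      have := mul_le_mul_of_nonneg_left hKη hC.le
      linarith
    · intro k
      have h1 := hB.le_mul_commSize k
      have h2 : (K n : ℝ) ≤ K₀ + 1 := by
        have : (K n : ℝ) ≤ K₀ := by exact_mod_cast hK₀ n (K n) (αs n) (ψs n) (hαsR n) hA
        linarith
      have h3 : (K n : ℝ) * c₃ ≤ (K₀ + 1) * max c₃ 1 :=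
        (mul_le_mul_of_nonneg_left (le_max_left c₃ 1) (by positivity)).trans
          (mul_le_mul_of_nonneg_right h2 (by positivity))
      rw [ha₀, one_div, inv_mul_le_iff₀ (by positivity)]
      exact h1.trans (mul_le_mul_of_nonneg_right h3 (by positivity))
    · -- the potential hyperedges with `m` vertices carry all tuples of distinct vertices
      have h1 := sum_injective_le_factorial_mul (n := n) (m := p + 1) (by omega)
        (fun f => (cpTensor (p + 1) (αs n) f - cpTensor (p + 1) (αh n ω) f) ^ 2)
        (fun f => sq_nonneg _) (fun f σ => by simp only [cpTensor_comp_perm])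
      have h2 : (phi n (p + 1) : ℝ) ≤ (p + 1 : ℕ) * (n : ℝ) ^ (p + 1) := by
        exact_mod_cast phi_le hn (p + 1)
      calc _ = ∑ f : Fin (p + 1) → Fin n with Function.Injective f,
            (cpTensor (p + 1) (αs n) (fun l => (f l).castSucc) -
              cpTensor (p + 1) (αh n ω) (fun l => (f l).castSucc)) ^ 2 :=
            Finset.sum_congr rfl fun f _ => sub_sq_comm _ _
        _ ≤ (p + 1).factorial * sqDist (p + 1) (αs n) (αh n ω) := h1
        _ ≤ (p + 1).factorial * (10 / κ * ((p + 1 : ℕ) * (n : ℝ) ^ (p + 1)) * (ε n / s n)) := by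
            gcongr
            refine hsq.trans ?_
            gcongr
        _ = Q₁ * (n : ℝ) ^ (p + 1) * (ε n / s n) := by rw [hQ₁]; ring
        _ ≤ Q * (n : ℝ) ^ (p + 1) * (ε n / s n) := by
            gcongr
            have : 0 < 5 / c := by positivity
            have : 0 < C₁ / c := by positivity
            linarith
    · refine hCh.trans ?_
      have h1 : 5 / c ≤ Q := by
        have : 0 < C₁ / c := by positivity
        linarith
      calc (n : ℝ) * J1 (K n) (αh n ω) ≤ n * (5 / c * (ε n / s n)) := by gcongr
        _ ≤ n * (Q * (ε n / s n)) := by gcongr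
        _ = _ := by ring
    · have h1 : C₁ / c ≤ Q := by
        have : 0 < 5 / c := by positivity
        linarith
      have h2 := sum_sq_sub_center_le (ψs n) (αs n) (withNullCenter (centers (αs n) (ψs n)))
      simp only [withNullCenter_castSucc] at h2
      calc _ ≤ _ := h2
        _ ≤ _ := hW
        _ ≤ n * (Q * (ε n / s n)) := by gcongr
        _ = _ := by ring
  · refine (grid_union_bound_le hr1 hn hφ hD0 hεn (hεη.trans hηD)
      (Nat.ceil_lt_add_one (by positivity)).le hrate).trans ?_
    rw [← Real.exp_log hδ, Real.exp_le_exp]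
    linarith
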